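/- Let $N\ge 0$ be an integer, let $\sigma\in\{1,-1\}$, let $\rho_1,\rho_2$ be nonzero real numbers, let $\alpha$ be real, and let $p_1,\dots,p_N$ and $\xi_{10},\dots,\xi_{N0}$ be complex numbers with $p_i+p_j^*\neq 0$ for all $i,j$ (where $^*$ is complex conjugation) and $$[p_i-\mathrm i\alpha(1+\sigma\rho_1\rho_2)]\,[p_i^*+\mathrm i\alpha(1+\sigma\rho_1\rho_2)]=\alpha^2\rho_1\rho_2(\sigma+\rho_1\rho_2),\qquad i=1,\dots,N.$$ (For $N\ge1$ these conditions force $\alpha\ne0$ and $\operatorname{Re}p_i\neq0$, so that all denominators below are nonzero; for $N=0$ the determinants below are $1$.) For real $x,t$ put $$\xi_i=\frac{\rho_2}{\alpha\rho_1}p_i x-\frac{\rho_1\alpha(1+\sigma\rho_1\rho_2)}{\rho_2}\frac{t}{p_i}+\xi_{i0},\qquad \theta=(1+\sigma\rho_1\rho_2)\Big(\frac{\rho_2}{\rho_1}x+\frac{\rho_1}{\rho_2}t\Big),$$ and define the $N\times N$ determinants $$f=\det\Big(\delta_{ij}+\frac{\mathrm i p_i}{p_i+p_j^*}e^{\xi_i+\xi_j^*}\Big),\qquad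 g=\det\Big(\delta_{ij}+\frac{-\mathrm i p_j^*}{p_i+p_j^*}\Big(-\frac{p_i-\mathrm i\alpha}{p_j^*+\mathrm i\alpha}\Big)e^{\xi_i+\xi_j^*}\Big),$$ $$h=\det\Big(\delta_{ij}+\frac{-\mathrm i p_j^*}{p_i+p_j^*}\Big[-\frac{p_i-\mathrm i\alpha(1+\sigma\rho_1\rho_2)}{p_j^*+\mathrm i\alpha(1+\sigma\rho_1\rho_2)}\Big]e^{\xi_i+\xi_j^*}\Big).$$ Then $f$ vanishes nowhere on $\mathbb R^2$, its complex conjugate is $$f^*=\det\Big(\delta_{ij}-\frac{\mathrm i p_j^*}{p_i+p_j^*}e^{\xi_i+\xi_j^*}\Big),$$ and the functions $$u=\rho_1\frac{g}{f^*}e^{\mathrm i\theta},\qquad v=\rho_2\frac{h}{f}e^{\mathrm i\theta}$$ are continuously differentiable on $\mathbb R^2$ and satisfy the massive Thirring model at every $(x,t)\in\mathbb R^2$: $$\mathrm i u_x+v+\sigma u|v|^2=0,\qquad \mathrm i v_t+u+\sigma v|u|^2=0.$$ -/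

import Mathlib

open scoped ComplexConjugate

noncomputable section

namespace MassiveThirring

/-- `(u, v)` is a classical (`C¹`, everywhere defined) solution of the massive Thirring model
`i u_x + v + σ u |v|² = 0`, `i v_t + u + σ v |u|² = 0`; functions are written `u x t`. -/
structure IsSolution (σ : ℝ) (u v : ℝ → ℝ → ℂ) : Prop where
  contDiff_u : ContDiff ℝ 1 (fun z : ℝ × ℝ => u z.1 z.2)
  contDiff_v : ContDiff ℝ 1 (fun z : ℝ × ℝ => v z.1 z.2)
  eq_x : ∀ x t : ℝ, Complex.I * deriv (fun y : ℝ => u y t) x + v x t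
    + (σ : ℂ) * u x t * ((‖v x t‖ ^ 2 : ℝ) : ℂ) = 0
  eq_t : ∀ x t : ℝ, Complex.I * deriv (fun s : ℝ => v x s) t + u x t
    + (σ : ℂ) * v x t * ((‖u x t‖ ^ 2 : ℝ) : ℂ) = 0

/-- `ξ = ρ₂/(α ρ₁) p x - (ρ₁ α (1 + σ ρ₁ ρ₂)/ρ₂) t/p + ξ₀`. -/
def xi (σ ρ₁ ρ₂ α : ℝ) (p ξ₀ : ℂ) (x t : ℝ) : ℂ :=
  (ρ₂ : ℂ) / (α * ρ₁) * p * x - (ρ₁ : ℂ) * α * (1 + σ * ρ₁ * ρ₂) / ρ₂ * (t / p) + ξ₀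

/-- The exponential `e^{ξ_i + ξ_j*}`. -/
def expFactor {N : ℕ} (σ ρ₁ ρ₂ α : ℝ) (p ξ₀ : Fin N → ℂ) (x t : ℝ) (i j : Fin N) : ℂ :=
  Complex.exp (xi σ ρ₁ ρ₂ α (p i) (ξ₀ i) x t + conj (xi σ ρ₁ ρ₂ α (p j) (ξ₀ j) x t))

/-- `f = |δ_ij + i p_i/(p_i + p_j*) e^{ξ_i + ξ_j*}|`. -/
def tauF {N : ℕ} (σ ρ₁ ρ₂ α : ℝ) (p ξ₀ : Fin N → ℂ) (x t : ℝ) : ℂ :=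
  Matrix.det (Matrix.of fun i j : Fin N => (if i = j then (1 : ℂ) else 0)
    + Complex.I * p i / (p i + conj (p j)) * expFactor σ ρ₁ ρ₂ α p ξ₀ x t i j)

/-- `|δ_ij - i p_j*/(p_i + p_j*) e^{ξ_i + ξ_j*}|`, the determinant given for `f*`. -/
def tauFStar {N : ℕ} (σ ρ₁ ρ₂ α : ℝ) (p ξ₀ : Fin N → ℂ) (x t : ℝ) : ℂ :=
  Matrix.det (Matrix.of fun i j : Fin N => (if i = j then (1 : ℂ) else 0)
    - Complex.I * conj (p j) / (p i + conj (p j)) * expFactor σ ρ₁ ρ₂ α p ξ₀ x t i j)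

/-- `g = |δ_ij + (-i p_j*)/(p_i + p_j*) (-(p_i - iα)/(p_j* + iα)) e^{ξ_i + ξ_j*}|`. -/
def tauG {N : ℕ} (σ ρ₁ ρ₂ α : ℝ) (p ξ₀ : Fin N → ℂ) (x t : ℝ) : ℂ :=
  Matrix.det (Matrix.of fun i j : Fin N => (if i = j then (1 : ℂ) else 0)
    + -Complex.I * conj (p j) / (p i + conj (p j))
      * (-((p i - Complex.I * α) / (conj (p j) + Complex.I * α)))
      * expFactor σ ρ₁ ρ₂ α p ξ₀ x t i j)

/-- `h = |δ_ij + (-i p_j*)/(p_i + p_j*) [-(p_i - iα(1+σρ₁ρ₂))/(p_j* + iα(1+σρ₁ρ₂))]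
e^{ξ_i + ξ_j*}|`. -/
def tauH {N : ℕ} (σ ρ₁ ρ₂ α : ℝ) (p ξ₀ : Fin N → ℂ) (x t : ℝ) : ℂ :=
  Matrix.det (Matrix.of fun i j : Fin N => (if i = j then (1 : ℂ) else 0)
    + -Complex.I * conj (p j) / (p i + conj (p j))
      * (-((p i - Complex.I * α * (1 + σ * ρ₁ * ρ₂))
          / (conj (p j) + Complex.I * α * (1 + σ * ρ₁ * ρ₂))))
      * expFactor σ ρ₁ ρ₂ α p ξ₀ x t i j)

/-- The background phase `e^{iθ}`, `θ = (1 + σ ρ₁ ρ₂) (ρ₂ x/ρ₁ + ρ₁ t/ρ₂)`. -/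
def phase (σ ρ₁ ρ₂ : ℝ) (x t : ℝ) : ℂ :=
  Complex.exp (Complex.I * (((1 + σ * ρ₁ * ρ₂) * (ρ₂ / ρ₁ * x + ρ₁ / ρ₂ * t) : ℝ) : ℂ))

/-- `u = ρ₁ (g / f*) e^{iθ}`, where `f*` is the complex conjugate of `f`. -/
def darkU {N : ℕ} (σ ρ₁ ρ₂ α : ℝ) (p ξ₀ : Fin N → ℂ) (x t : ℝ) : ℂ :=
  ρ₁ * (tauG σ ρ₁ ρ₂ α p ξ₀ x t / conj (tauF σ ρ₁ ρ₂ α p ξ₀ x t)) * phase σ ρ₁ ρ₂ x t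

/-- `v = ρ₂ (h / f) e^{iθ}`. -/
def darkV {N : ℕ} (σ ρ₁ ρ₂ α : ℝ) (p ξ₀ : Fin N → ℂ) (x t : ℝ) : ℂ :=
  ρ₂ * (tauH σ ρ₁ ρ₂ α p ξ₀ x t / tauF σ ρ₁ ρ₂ α p ξ₀ x t) * phase σ ρ₁ ρ₂ x t

end MassiveThirring

end

/-! Put `c_i = e^{ξ_i}`, `d_i = e^{ξ_i*}` and let `A` be the matrix with `f = det A`. The matrices
of `f*`, `g`, `h`, `g*`, `h*` differ from `A` by rank one, so the matrix determinant lemma makes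
each quotient by `f` equal to one plus a multiple of a scalar `d^T S A⁻¹ T c` with `S`, `T` diagonal
(a `bracket`). Differentiating `c_i d_j` cancels the denominators `p_i + p_j*`, so `A_x` and `A_t`
also have rank one, and derivatives of brackets are quadratic in brackets (`hasDerivAt_bracket`).
The Thirring system then follows from four bracket identities.

They rest on the constraint, which reads `q_i q'_i = a(a - α)` with `a = α(1 + σρ₁ρ₂)`, `q = p -
ia`, `q' = p* + ia`. Since `q_i + q'_j = p_i + p_j*`, it gives `q_j (p_i + p_j*) = q_i (p_j +
p_i*)`. Hence `A` is symmetric up to diagonal scaling (`bracket_dressing_swap`), and its commutators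
with `diag(p - p*)` and `diag(1/p - 1/p*)` have rank at most two (`bracket_dressing_comm`,
`bracket_dressing_comm_inv`). This part is algebraic, with `p*` replaced by an independent `p'`.

Nonvanishing of `f` uses conjugation: `A = 1 + iPM` with `M` Hermitian. A displacement identity for
`M` shows that `ker A` is stable under `diag(1/|p|²)`. An eigenvector in the kernel is supported on
indices sharing one value of `p`, and there the kernel equation contradicts `Re p ≠ 0`
(`det_dressing_ne_zero`). -/

noncomputable section

namespace MassiveThirring

/-! ### Brackets: determinant lemma, commutator rule, transposition, derivative. -/

section Bracket

variable {n : Type*} [Fintype n] [DecidableEq n]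

/-- The bilinear form `∑ d_i s_i (A⁻¹)_ij t_j c_j` attached to a matrix `A` and vectors `c`, `d`. -/
def bracket (A : Matrix n n ℂ) (c d s t : n → ℂ) : ℂ :=
  ∑ i, ∑ j, d i * s i * A⁻¹ i j * (t j * c j)

theorem bracket_left_comb (A : Matrix n n ℂ) (c d : n → ℂ) {s s₁ s₂ : n → ℂ} (t : n → ℂ) (y z : ℂ)
    (h : ∀ i, s i = y * s₁ i + z * s₂ i) :
    bracket A c d s t = y * bracket A c d s₁ t + z * bracket A c d s₂ t := by
  simp only [bracket, Finset.mul_sum, ← Finset.sum_add_distrib, h]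
  refine Finset.sum_congr rfl fun i _ => Finset.sum_congr rfl fun j _ => ?_
  ring

theorem bracket_right_comb (A : Matrix n n ℂ) (c d s : n → ℂ) {t t₁ t₂ : n → ℂ} (y z : ℂ)
    (h : ∀ i, t i = y * t₁ i + z * t₂ i) :
    bracket A c d s t = y * bracket A c d s t₁ + z * bracket A c d s t₂ := by
  simp only [bracket, Finset.mul_sum, ← Finset.sum_add_distrib, h]
  refine Finset.sum_congr rfl fun i _ => Finset.sum_congr rfl fun j _ => ?_
  ring

theorem bracket_eq_dotProduct (A : Matrix n n ℂ) (c d s t : n → ℂ) :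
    bracket A c d s t = (fun i => d i * s i) ⬝ᵥ (A⁻¹.mulVec fun j => t j * c j) := by
  simp only [bracket, dotProduct, Matrix.mulVec, Finset.mul_sum, mul_assoc]

/-- A double sum of a rank one matrix between two inverses is a product of brackets. -/
theorem sum_inv_vecMulVec_inv (A : Matrix n n ℂ) (c d s t r₁ s₁ : n → ℂ) :
    ∑ i, ∑ j, d i * s i
      * (A⁻¹ * Matrix.vecMulVec (fun i => r₁ i * c i) (fun j => d j * s₁ j) * A⁻¹) i j * (t j * c j)
      = bracket A c d s r₁ * bracket A c d s₁ t := by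
  rw [bracket_eq_dotProduct, bracket_eq_dotProduct]
  rw [Matrix.mul_vecMulVec, Matrix.vecMulVec_mul, Matrix.dotProduct_mulVec (fun i => d i * s₁ i)]
  simp only [Matrix.vecMulVec_apply, dotProduct]
  rw [Finset.sum_mul_sum]
  refine Finset.sum_congr rfl fun i _ => Finset.sum_congr rfl fun j _ => ?_
  ring

theorem det_add_rank_one {A : Matrix n n ℂ} (hA : A.det ≠ 0) (c d r s : n → ℂ) :
    (Matrix.of fun i j => A i j + r i * c i * (d j * s j)).det
      = A.det * (1 + bracket A c d s r) := by
  have h : (Matrix.of fun i j => A i j + r i * c i * (d j * s j))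
      = A + Matrix.replicateCol Unit (fun i => r i * c i)
        * Matrix.replicateRow Unit (fun j => d j * s j) := by
    ext i j
    simp [Matrix.mul_apply]
  rw [h, Matrix.det_add_replicateCol_mul_replicateRow (isUnit_iff_ne_zero.mpr hA),
    bracket_eq_dotProduct, Matrix.dotProduct_mulVec]
  congr 1
  rw [Matrix.det_unique, Matrix.add_apply, Matrix.one_apply_eq]
  congr 1

/-- From `A⁻¹Δ - ΔA⁻¹ = A⁻¹(ΔA - AΔ)A⁻¹`: each rank-one piece of the commutator contributes a
product of two brackets. -/
theorem bracket_comm {A : Matrix n n ℂ} (hA : A.det ≠ 0) (c d : n → ℂ)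
    {δ r₁ s₁ r₂ s₂ : n → ℂ}
    (h : ∀ i j, δ i * A i j - A i j * δ j
      = r₁ i * c i * (d j * s₁ j) - r₂ i * c i * (d j * s₂ j)) (s t : n → ℂ) :
    bracket A c d s (fun i => δ i * t i) - bracket A c d (fun i => δ i * s i) t
      = bracket A c d s r₁ * bracket A c d s₁ t - bracket A c d s r₂ * bracket A c d s₂ t := by
  have hu : IsUnit A.det := isUnit_iff_ne_zero.mpr hA
  have h1 : Matrix.diagonal δ * A - A * Matrix.diagonal δ
      = Matrix.vecMulVec (fun i => r₁ i * c i) (fun j => d j * s₁ j)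
        - Matrix.vecMulVec (fun i => r₂ i * c i) (fun j => d j * s₂ j) := by
    ext i j
    simpa [Matrix.diagonal_mul, Matrix.mul_diagonal, Matrix.vecMulVec_apply] using h i j
  have h2 : A⁻¹ * Matrix.diagonal δ - Matrix.diagonal δ * A⁻¹
      = A⁻¹ * Matrix.vecMulVec (fun i => r₁ i * c i) (fun j => d j * s₁ j) * A⁻¹
        - A⁻¹ * Matrix.vecMulVec (fun i => r₂ i * c i) (fun j => d j * s₂ j) * A⁻¹ := by
    rw [← Matrix.sub_mul, ← Matrix.mul_sub, ← h1, Matrix.mul_sub, Matrix.sub_mul,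
      ← Matrix.mul_assoc, Matrix.mul_assoc _ A A⁻¹, Matrix.mul_nonsing_inv A hu, Matrix.mul_one,
      ← Matrix.mul_assoc, Matrix.nonsing_inv_mul A hu, Matrix.one_mul]
  rw [← sum_inv_vecMulVec_inv, ← sum_inv_vecMulVec_inv]
  simp only [bracket, ← Finset.sum_sub_distrib]
  refine Finset.sum_congr rfl fun i _ => Finset.sum_congr rfl fun j _ => ?_
  have h3 := congrFun (congrFun h2 i) j
  simp only [Matrix.sub_apply, Matrix.diagonal_mul, Matrix.mul_diagonal] at h3
  linear_combination d i * s i * (t j * c j) * h3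

/-- A scalar equals its transpose. If `diag e` symmetrizes `A` it also symmetrizes `A⁻¹`, and `w`
records how far `d` is from `e c`. -/
theorem bracket_swap {A : Matrix n n ℂ} (hA : A.det ≠ 0) (c d : n → ℂ) {e w : n → ℂ}
    (hA' : ∀ i j, A j i * e j = e i * A i j) (hw : ∀ i, d i = w i * e i * c i) (hw0 : ∀ i, w i ≠ 0) (s t : n → ℂ) :
    bracket A c d s t = bracket A c d (fun i => t i / w i) (fun i => s i * w i) := by
  have hu : IsUnit A.det := isUnit_iff_ne_zero.mpr hA
  have hut : IsUnit A.transpose.det := by rwa [Matrix.det_transpose]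
  have h1 : A.transpose * Matrix.diagonal e = Matrix.diagonal e * A := by
    ext i j
    simpa [Matrix.diagonal_mul, Matrix.mul_diagonal] using hA' i j
  have h2 : Matrix.diagonal e * A⁻¹ = (A⁻¹).transpose * Matrix.diagonal e := by
    rw [Matrix.transpose_nonsing_inv]
    calc Matrix.diagonal e * A⁻¹
        = A.transpose⁻¹ * (A.transpose * Matrix.diagonal e) * A⁻¹ := by
          rw [← Matrix.mul_assoc, Matrix.nonsing_inv_mul _ hut, Matrix.one_mul]
      _ = A.transpose⁻¹ * Matrix.diagonal e := by
          rw [h1, Matrix.mul_assoc, Matrix.mul_assoc, Matrix.mul_nonsing_inv _ hu, Matrix.mul_one]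
  rw [bracket, bracket, Finset.sum_comm]
  refine Finset.sum_congr rfl fun j _ => Finset.sum_congr rfl fun i _ => ?_
  have h3 := congrFun (congrFun h2 i) j
  simp only [Matrix.diagonal_mul, Matrix.mul_diagonal, Matrix.transpose_apply] at h3
  rw [hw i, hw j]
  have := hw0 j
  field_simp
  linear_combination c i * c j * w i * s i * t j * h3

/-- Cramer's rule gives differentiability of the entries; the value then comes from differentiating
`A A⁻¹ = 1`. -/
theorem hasDerivAt_inv_apply {A : ℝ → Matrix n n ℂ} {A' : Matrix n n ℂ} {x : ℝ}
    (hA : ∀ y, (A y).det ≠ 0) (h : ∀ i j, HasDerivAt (fun y => A y i j) (A' i j) x) (i j : n) :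
    HasDerivAt (fun y => (A y)⁻¹ i j) (-((A x)⁻¹ * A' * (A x)⁻¹) i j) x := by
  have hu : ∀ y, IsUnit (A y).det := fun y => isUnit_iff_ne_zero.mpr (hA y)
  have hdet : ∀ B : ℝ → Matrix n n ℂ, (∀ i j, DifferentiableAt ℝ (fun y => B y i j) x) →
      DifferentiableAt ℝ (fun y => (B y).det) x := by
    intro B hB
    simp only [Matrix.det_apply]
    fun_prop
  have hd : ∀ i j, DifferentiableAt ℝ (fun y => (A y)⁻¹ i j) x := by
    intro i j
    simp only [Matrix.inv_def, Ring.inverse_eq_inv', Matrix.smul_apply, Matrix.adjugate_apply,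
      smul_eq_mul]
    refine DifferentiableAt.mul (DifferentiableAt.inv (hdet _ fun i j => (h i j).differentiableAt)
      (hA x)) (hdet _ fun k l => ?_)
    -- The adjugate entry is the determinant of `A` with row `j` replaced by a constant row.
    by_cases hk : k = j
    · subst hk
      simp
    · simp only [Matrix.updateRow_ne hk]
      exact (h k l).differentiableAt
  set B' : Matrix n n ℂ := Matrix.of fun i j => deriv (fun y => (A y)⁻¹ i j) x with hB'
  have hB : ∀ i j, HasDerivAt (fun y => (A y)⁻¹ i j) (B' i j) x := fun i j => (hd i j).hasDerivAt
  have h0 : A' * (A x)⁻¹ + A x * B' = 0 := by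
    ext i j
    have h1 : HasDerivAt (fun y => ∑ k, A y i k * (A y)⁻¹ k j)
        (∑ k, (A' i k * (A x)⁻¹ k j + A x i k * B' k j)) x :=
      HasDerivAt.fun_sum fun k _ => (h i k).mul (hB k j)
    have h2 : (fun y => ∑ k, A y i k * (A y)⁻¹ k j) = fun _ => (1 : Matrix n n ℂ) i j := by
      funext y
      rw [← Matrix.mul_apply, Matrix.mul_nonsing_inv _ (hu y)]
    rw [h2] at h1
    have := h1.unique (hasDerivAt_const x _)
    simpa [Matrix.mul_apply, Finset.sum_add_distrib] using this
  have h3 : B' = -((A x)⁻¹ * A' * (A x)⁻¹) := by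
    have := congrArg (fun M => (A x)⁻¹ * M) h0
    simp only [Matrix.mul_add, ← Matrix.mul_assoc, Matrix.nonsing_inv_mul _ (hu x), Matrix.one_mul,
      Matrix.mul_zero] at this
    exact (neg_eq_of_add_eq_zero_right this).symm
  rw [← Matrix.neg_apply, ← h3]
  exact hB i j

theorem hasDerivAt_bracket {A : ℝ → Matrix n n ℂ} {c d : ℝ → n → ℂ} {lam mu r s : n → ℂ} {x : ℝ}
    (hA : ∀ y, (A y).det ≠ 0)
    (hA' : ∀ i j, HasDerivAt (fun y => A y i j) (r i * c x i * (d x j * s j)) x)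
    (hc : ∀ i, HasDerivAt (fun y => c y i) (lam i * c x i) x)
    (hd : ∀ i, HasDerivAt (fun y => d y i) (mu i * d x i) x) (S T : n → ℂ) :
    HasDerivAt (fun y => bracket (A y) (c y) (d y) S T)
      (bracket (A x) (c x) (d x) (fun i => mu i * S i) T
        + bracket (A x) (c x) (d x) S (fun i => lam i * T i)
        - bracket (A x) (c x) (d x) S r * bracket (A x) (c x) (d x) s T) x := by
  have hinv := hasDerivAt_inv_apply
    (A' := Matrix.vecMulVec (fun i => r i * c x i) (fun j => d x j * s j)) hA hA'
  have h1 := HasDerivAt.fun_sum (u := Finset.univ) fun i _ =>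
    HasDerivAt.fun_sum (u := Finset.univ) fun j _ =>
      (((hd i).mul_const (S i)).mul (hinv i j)).mul ((hc j).const_mul (T j))
  refine h1.congr_deriv ?_
  rw [← sum_inv_vecMulVec_inv]
  simp only [bracket, ← Finset.sum_sub_distrib, ← Finset.sum_add_distrib]
  refine Finset.sum_congr rfl fun i _ => Finset.sum_congr rfl fun j _ => ?_
  simp only [Pi.mul_apply]
  ring

end Bracket

/-! ### Algebra of the dressing matrix under the circle constraint. -/

section Dressing

/-- The matrix `δ_ij + i p_i/(p_i + p'_j) c_i d_j`. -/
def dressing {n : Type*} [DecidableEq n] (p p' c d : n → ℂ) : Matrix n n ℂ :=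
  Matrix.of fun i j => (if i = j then (1 : ℂ) else 0)
    + Complex.I * p i / (p i + p' j) * (c i * d j)

/-- The algebraic conditions on the spectral parameters `p_i`, `p'_i`: with `q = p - ia` and
`q' = p' + ia`, the products `q_i q'_i` all have the nonzero value `a (a - α)`. -/
structure IsCircular {n : Type*} (a α : ℂ) (p p' : n → ℂ) : Prop where
  add_ne : ∀ i j, p i + p' j ≠ 0
  p_ne : ∀ i, p i ≠ 0
  p'_ne : ∀ i, p' i ≠ 0
  a_ne : a ≠ 0
  sub_ne : a - α ≠ 0
  mul_eq : ∀ i, (p i - Complex.I * a) * (p' i + Complex.I * a) = a * (a - α)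

namespace IsCircular

variable {n : Type*} {a α : ℂ} {p p' : n → ℂ}

theorem q_ne (h : IsCircular a α p p') (i : n) : p i - Complex.I * a ≠ 0 :=
  left_ne_zero_of_mul (h.mul_eq i ▸ mul_ne_zero h.a_ne h.sub_ne)

theorem q'_ne (h : IsCircular a α p p') (i : n) : p' i + Complex.I * a ≠ 0 :=
  right_ne_zero_of_mul (h.mul_eq i ▸ mul_ne_zero h.a_ne h.sub_ne)

/-- This trades the shift `α` for the shift `a`: `1/(p' + iα)` is a constant multiple of `q/p`, so
brackets from `g` and from `h` become comparable. -/
theorem q_mul_b' (h : IsCircular a α p p') (i : n) :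
    (p i - Complex.I * a) * (p' i + Complex.I * α) = -Complex.I * (a - α) * p i := by
  linear_combination h.mul_eq i + a * (a - α) * Complex.I_sq

theorem q'_mul_b (h : IsCircular a α p p') (i : n) :
    (p' i + Complex.I * a) * (p i - Complex.I * α) = Complex.I * (a - α) * p' i := by
  linear_combination h.mul_eq i + a * (a - α) * Complex.I_sq

theorem b'_ne (h : IsCircular a α p p') (i : n) : p' i + Complex.I * α ≠ 0 := by
  refine right_ne_zero_of_mul (a := p i - Complex.I * a) ?_
  rw [h.q_mul_b' i]
  exact mul_ne_zero (mul_ne_zero (neg_ne_zero.mpr Complex.I_ne_zero) h.sub_ne) (h.p_ne i)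

theorem b_ne (h : IsCircular a α p p') (i : n) : p i - Complex.I * α ≠ 0 := by
  refine right_ne_zero_of_mul (a := p' i + Complex.I * a) ?_
  rw [h.q'_mul_b i]
  exact mul_ne_zero (mul_ne_zero Complex.I_ne_zero h.sub_ne) (h.p'_ne i)

/-- The constraint makes `p p'` determine `p - p'`, hence the unordered pair `{p, -p'}`; the
alternative `p_i = -p'_j` is excluded. -/
theorem eq_of_mul_eq (h : IsCircular a α p p') {i j : n} (hij : p i * p' i = p j * p' j) :
    p i = p j := by
  have h1 : a * ((p i - p' i) - (p j - p' j)) = 0 := by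
    linear_combination -Complex.I * (h.mul_eq i - h.mul_eq j - hij)
      + a * ((p i - p' i) - (p j - p' j)) * Complex.I_sq
  have h2 := (mul_eq_zero.mp h1).resolve_left h.a_ne
  have h3 : (p i - p j) * (p i + p' j) = 0 := by
    linear_combination p i * h2 + hij
  exact sub_eq_zero.mp ((mul_eq_zero.mp h3).resolve_right (h.add_ne i j))

variable [Fintype n] [DecidableEq n] {c d : n → ℂ}

/-- Since `q_j (p_i + p'_j) = q_i (p_j + p'_i)`, the diagonal matrix with entries `q d/(c p)`
symmetrizes the dressing matrix; the resulting weight is `w = p/q`. -/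
theorem bracket_dressing_swap (h : IsCircular a α p p') (hc : ∀ i, c i ≠ 0)
    (hA : (dressing p p' c d).det ≠ 0) {s t s₁ t₁ : n → ℂ}
    (hs : ∀ i, s₁ i * p i = t i * (p i - Complex.I * a))
    (ht : ∀ i, t₁ i * (p i - Complex.I * a) = s i * p i) :
    bracket (dressing p p' c d) c d s t = bracket (dressing p p' c d) c d s₁ t₁ := by
  have h1 : s₁ = fun i => t i / (p i / (p i - Complex.I * a)) := by
    funext i
    have := h.p_ne i
    have := h.q_ne i
    field_simp
    exact hs i
  have h2 : t₁ = fun i => s i * (p i / (p i - Complex.I * a)) := by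
    funext i
    have := h.q_ne i
    field_simp
    exact ht i
  rw [h1, h2]
  refine bracket_swap (e := fun i => (p i - Complex.I * a) * d i / (c i * p i)) hA c d ?_ ?_ ?_ s t
  · intro i j
    have := h.p_ne i
    have := h.p_ne j
    have h3 := h.add_ne i j
    have h4 := h.add_ne j i
    have := hc i
    have := hc j
    rcases eq_or_ne i j with rfl | hij
    · ring
    · simp only [dressing, Matrix.of_apply, if_neg hij, if_neg hij.symm, zero_add]
      field_simp
      linear_combination d i * d j * (h.mul_eq j - h.mul_eq i)
  · intro i
    have := h.p_ne i
    have := h.q_ne i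
    have := hc i
    field_simp
  · intro i
    exact div_ne_zero (h.p_ne i) (h.q_ne i)

/-- The constraint factors `(p_i - p'_i) - (p_j - p'_j)` as `(p_i + p'_j)(1 - q_j/q_i)`; the
denominator cancels and rank two remains. -/
theorem bracket_dressing_comm (h : IsCircular a α p p') (hA : (dressing p p' c d).det ≠ 0)
    (s t : n → ℂ) :
    bracket (dressing p p' c d) c d s (fun i => (p i - p' i) * t i)
      - bracket (dressing p p' c d) c d (fun i => (p i - p' i) * s i) t
    = Complex.I * (bracket (dressing p p' c d) c d s p
        * bracket (dressing p p' c d) c d (fun _ => 1) t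
      - bracket (dressing p p' c d) c d s (fun i => p i / (p i - Complex.I * a))
        * bracket (dressing p p' c d) c d (fun i => p i - Complex.I * a) t) := by
  rw [bracket_comm (δ := fun i => p i - p' i) (r₁ := fun i => Complex.I * p i) (s₁ := fun _ => 1)
    (r₂ := fun i => Complex.I * (p i / (p i - Complex.I * a)))
    (s₂ := fun i => p i - Complex.I * a) hA]
  -- The two-term rule serves as a scaling rule: the second vector is a dummy with coefficient `0`.
  · rw [bracket_right_comb _ c d s (t := fun i => Complex.I * p i) (t₁ := p) (t₂ := p) Complex.I 0
        (fun i => by ring),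
      bracket_right_comb _ c d s (t₁ := fun i => p i / (p i - Complex.I * a))
        (t := fun i => Complex.I * (p i / (p i - Complex.I * a)))
        (t₂ := p) Complex.I 0 (fun i => by ring)]
    ring
  · intro i j
    have := h.q_ne i
    have := h.add_ne i j
    rcases eq_or_ne i j with rfl | hij
    · simp only [dressing, Matrix.of_apply]
      field_simp
      ring
    · simp only [dressing, Matrix.of_apply, if_neg hij, zero_add]
      field_simp
      linear_combination p i * c i * d j * (h.mul_eq j - h.mul_eq i)

/-- Here the difference of the diagonal entries is `(p_i + p'_j)(1/(p_i p'_j) - q_j/(q_i p_j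
p'_i))`. -/
theorem bracket_dressing_comm_inv (h : IsCircular a α p p') (hA : (dressing p p' c d).det ≠ 0)
    (s t : n → ℂ) :
    bracket (dressing p p' c d) c d s (fun i => (1 / p i - 1 / p' i) * t i)
      - bracket (dressing p p' c d) c d (fun i => (1 / p i - 1 / p' i) * s i) t
    = Complex.I * (bracket (dressing p p' c d) c d s (fun _ => 1)
        * bracket (dressing p p' c d) c d (fun i => 1 / p' i) t
      - bracket (dressing p p' c d) c d s (fun i => p i / (p' i * (p i - Complex.I * a)))
        * bracket (dressing p p' c d) c d (fun i => (p i - Complex.I * a) / p i) t) := by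
  rw [bracket_comm (δ := fun i => 1 / p i - 1 / p' i) (r₁ := fun i => Complex.I * 1)
    (s₁ := fun i => 1 / p' i)
    (r₂ := fun i => Complex.I * (p i / (p' i * (p i - Complex.I * a))))
    (s₂ := fun i => (p i - Complex.I * a) / p i) hA]
  · rw [bracket_right_comb _ c d s (t := fun i => Complex.I * 1) (t₁ := fun _ => 1) (t₂ := p)
        Complex.I 0 (fun i => by ring),
      bracket_right_comb _ c d s (t₁ := fun i => p i / (p' i * (p i - Complex.I * a)))
        (t := fun i => Complex.I * (p i / (p' i * (p i - Complex.I * a))))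
        (t₂ := p) Complex.I 0 (fun i => by ring)]
    ring
  · intro i j
    have := h.q_ne i
    have := h.p_ne i
    have := h.p'_ne i
    have := h.p_ne j
    have := h.p'_ne j
    have := h.add_ne i j
    rcases eq_or_ne i j with rfl | hij
    · simp only [dressing, Matrix.of_apply]
      field_simp
      ring
    · simp only [dressing, Matrix.of_apply, if_neg hij, zero_add]
      field_simp
      linear_combination p i * p' j * c i * d j * (h.mul_eq j - h.mul_eq i)

/-- The left bracket occurs in the `x`-derivative of `g/f`; a swap converts it to the bracket of
`h/f`. -/
theorem bracket_b'_p (h : IsCircular a α p p') (hc : ∀ i, c i ≠ 0)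
    (hA : (dressing p p' c d).det ≠ 0) :
    bracket (dressing p p' c d) c d (fun i => 1 / (p' i + Complex.I * α)) p
      = Complex.I * a
        * bracket (dressing p p' c d) c d (fun i => 1 / (p' i + Complex.I * a)) (fun _ => 1) := by
  have e := h.sub_ne
  rw [h.bracket_dressing_swap (s₁ := fun i => p i - Complex.I * a)
    (t₁ := fun i => p i / ((p i - Complex.I * a) * (p' i + Complex.I * α))) hc hA
    (fun i => by ring)
    (fun i => by have := h.q_ne i; have := h.b'_ne i; field_simp)]
  rw [bracket_right_comb _ c d _ (t₁ := fun _ => 1) (t₂ := fun _ => 0) (Complex.I / (a - α)) 0,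
    bracket_left_comb _ c d (s := fun i => p i - Complex.I * a)
      (s₁ := fun i => 1 / (p' i + Complex.I * a)) (s₂ := fun _ => 0) _ (a * (a - α)) 0]
  · field_simp
    ring
  · intro i
    have := h.q'_ne i
    field_simp
    linear_combination h.mul_eq i
  · intro i
    rw [h.q_mul_b' i]
    have := h.p_ne i
    have := Complex.I_ne_zero
    field_simp
    linear_combination -Complex.I_sq

/-- The right side is, up to a constant factor, the `x`-derivative of `f*/f`, and the left side
involves `h h*`. It is the commutator with `p - p'` at `s = t = 1`. -/
theorem bracket_identity_x (h : IsCircular a α p p') (hA : (dressing p p' c d).det ≠ 0) :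
    let br := bracket (dressing p p' c d) c d
    (a - α) * (1 - Complex.I * br (fun _ => 1) (fun _ => 1)
      - (1 + a * br (fun i => 1 / (p' i + Complex.I * a)) (fun _ => 1))
        * (1 - Complex.I * br (fun _ => 1) (fun i => p i / (p i - Complex.I * a))))
    = -(br p' (fun _ => 1)
      + br (fun _ => 1) p * (1 - Complex.I * br (fun _ => 1) (fun _ => 1))) := by
  intro br
  have k := h.bracket_dressing_comm hA (fun _ => 1) (fun _ => 1)
  change br _ _ - br _ _ = Complex.I * (br _ _ * br _ _ - br _ _ * br _ _) at k
  have k1 : br (fun _ => 1) (fun i => (p i - p' i) * 1)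
      = 1 * br (fun _ => 1) p + (-1) * br (fun _ => 1) p' :=
    bracket_right_comb _ c d _ _ _ fun i => by ring
  have k2 : br (fun i => (p i - p' i) * 1) (fun _ => 1)
      = 1 * br p (fun _ => 1) + (-1) * br p' (fun _ => 1) :=
    bracket_left_comb _ c d _ _ _ fun i => by ring
  have k3 : br (fun i => p i - Complex.I * a) (fun _ => 1)
      = 1 * br p (fun _ => 1) + (-(Complex.I * a)) * br (fun _ => 1) (fun _ => 1) :=
    bracket_left_comb _ c d _ _ _ fun i => by ring
  have k4 : br (fun i => p i - Complex.I * a) (fun _ => 1)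
      = (a * (a - α)) * br (fun i => 1 / (p' i + Complex.I * a)) (fun _ => 1)
        + 0 * br p (fun _ => 1) :=
    bracket_left_comb _ c d _ _ _ fun i => by
      have := h.q'_ne i
      field_simp
      linear_combination h.mul_eq i
  have k5 : br (fun _ => 1) p'
      = (-Complex.I * (a - α)) * br (fun _ => 1) (fun i => p i / (p i - Complex.I * a))
        + (-Complex.I * α) * br (fun _ => 1) (fun _ => 1) :=
    bracket_right_comb _ c d _ _ _ fun i => by
      have := h.q_ne i
      field_simp
      linear_combination h.mul_eq i + a * (a - α) * Complex.I_sq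
  rw [k1, k2] at k
  clear_value br
  linear_combination k
    + (1 - Complex.I * br (fun _ => 1) (fun i => p i / (p i - Complex.I * a))) * k4 - k3 + k5

/-- The counterpart for the `t`-derivative of `f*/f` and `g g*`, from the commutator with `1/p -
1/p'`. -/
theorem bracket_identity_t (h : IsCircular a α p p') (hA : (dressing p p' c d).det ≠ 0) :
    let br := bracket (dressing p p' c d) c d
    (a - α) * (1 - Complex.I * br (fun _ => 1) (fun _ => 1)
      - (1 + α * br (fun i => 1 / (p' i + Complex.I * α)) (fun _ => 1))
        * (1 - Complex.I * br (fun _ => 1) (fun i => p i / (p i - Complex.I * α))))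
    = -(α * a) * (br (fun i => 1 / p' i) (fun _ => 1)
        * (1 - Complex.I * br (fun _ => 1) (fun _ => 1)) + br (fun _ => 1) (fun i => 1 / p i)) := by
  intro br
  have k := h.bracket_dressing_comm_inv hA (fun _ => 1) (fun _ => 1)
  change br _ _ - br _ _ = Complex.I * (br _ _ * br _ _ - br _ _ * br _ _) at k
  have k1 : br (fun _ => 1) (fun i => (1 / p i - 1 / p' i) * 1)
      = 1 * br (fun _ => 1) (fun i => 1 / p i) + (-1) * br (fun _ => 1) (fun i => 1 / p' i) :=
    bracket_right_comb _ c d _ _ _ fun i => by ring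
  have k2 : br (fun i => (1 / p i - 1 / p' i) * 1) (fun _ => 1)
      = 1 * br (fun i => 1 / p i) (fun _ => 1) + (-1) * br (fun i => 1 / p' i) (fun _ => 1) :=
    bracket_left_comb _ c d _ _ _ fun i => by ring
  have kZ : br (fun i => (p i - Complex.I * a) / p i) (fun _ => 1)
      = -Complex.I * (a - α) * br (fun i => 1 / (p' i + Complex.I * α)) (fun _ => 1)
        + 0 * br p (fun _ => 1) :=
    bracket_left_comb _ c d _ _ _ fun i => by
      have := h.b'_ne i
      have := h.p_ne i
      field_simp
      linear_combination h.q_mul_b' i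
  have kZ2 : br (fun i => (p i - Complex.I * a) / p i) (fun _ => 1)
      = 1 * br (fun _ => 1) (fun _ => 1)
        + (-(Complex.I * a)) * br (fun i => 1 / p i) (fun _ => 1) :=
    bracket_left_comb _ c d _ _ _ fun i => by
      have := h.p_ne i
      field_simp
      ring
  have kY : br (fun _ => 1) (fun i => p i / (p i - Complex.I * α))
      = (-(Complex.I * a)) * br (fun _ => 1) (fun i => p i / (p' i * (p i - Complex.I * a)))
        + 0 * br (fun _ => 1) p :=
    bracket_right_comb _ c d _ _ _ fun i => by
      have := h.b_ne i
      have := h.q_ne i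
      have := h.p'_ne i
      field_simp
      linear_combination p i * (h.mul_eq i + a * (a - α) * Complex.I_sq)
  have kY2 : br (fun _ => 1) (fun _ => 1)
      = (-Complex.I * (a - α)) * br (fun _ => 1) (fun i => p i / (p' i * (p i - Complex.I * a)))
        + (-Complex.I * α) * br (fun _ => 1) (fun i => 1 / p' i) :=
    bracket_right_comb _ c d _ _ _ fun i => by
      have := h.q_ne i
      have := h.p'_ne i
      field_simp
      linear_combination h.mul_eq i + a * (a - α) * Complex.I_sq
  rw [k1, k2] at k
  clear_value br
  linear_combination α * a * k
    + (a - α) * (Complex.I + Complex.I * α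
      * br (fun i => 1 / (p' i + Complex.I * α)) (fun _ => 1)) * kY
    + (Complex.I * α - Complex.I * α * a
      * br (fun _ => 1) (fun i => p i / (p' i * (p i - Complex.I * a)))) * kZ
    - Complex.I * a * kY2 - Complex.I * α * kZ2
    + (α * a * br (fun _ => 1) (fun i => 1 / p' i)
      - (a - α) * α * br (fun i => 1 / (p' i + Complex.I * α)) (fun _ => 1)
      + α * a * br (fun i => 1 / p i) (fun _ => 1)) * Complex.I_sq

/-- This links the `t`-derivative of `h/f*` to `g`. It combines a commutator with the swap symmetry.
-/
theorem bracket_identity_mixed (h : IsCircular a α p p') (hc : ∀ i, c i ≠ 0)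
    (hA : (dressing p p' c d).det ≠ 0) :
    let br := bracket (dressing p p' c d) c d
    a ^ 2 * (br (fun i => 1 / (p' i + Complex.I * a)) (fun _ => 1)
        * br (fun _ => 1) (fun i => 1 / p i)
      - br (fun i => 1 / (p' i + Complex.I * a)) (fun i => 1 / p i)
        * br (fun _ => 1) (fun _ => 1))
      - Complex.I * a ^ 2 * br (fun i => 1 / (p' i + Complex.I * a)) (fun i => 1 / p i)
      + a * br (fun _ => 1) (fun i => 1 / p i) + Complex.I * br (fun _ => 1) (fun _ => 1)
      + α * br (fun i => 1 / (p' i + Complex.I * α)) (fun _ => 1) = 0 := by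
  intro br
  -- The left weight `q/p` is the inverse of the swap weight, so swapping a bracket leaves `1` in
  -- its right slot.
  have k := h.bracket_dressing_comm hA (fun i => (p i - Complex.I * a) / p i) (fun i => 1 / p i)
  change br _ _ - br _ _ = Complex.I * (br _ _ * br _ _ - br _ _ * br _ _) at k
  have s1 : br (fun i => (p i - Complex.I * a) / p i) p
      = br (fun i => p i - Complex.I * a) (fun _ => 1) :=
    h.bracket_dressing_swap hc hA (fun i => by ring)
      (fun i => by have := h.p_ne i; field_simp)
  have s2 : br (fun i => (p i - Complex.I * a) / p i) (fun i => p i / (p i - Complex.I * a))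
      = br (fun _ => 1) (fun _ => 1) :=
    h.bracket_dressing_swap hc hA (fun i => by have := h.q_ne i; field_simp)
      (fun i => by have := h.p_ne i; field_simp)
  have s3 : br (fun i => (p i - Complex.I * a) / p i) (fun i => 1 / (p i - Complex.I * a))
      = br (fun i => 1 / p i) (fun _ => 1) :=
    h.bracket_dressing_swap hc hA
      (fun i => by have := h.q_ne i; have := h.p_ne i; field_simp)
      (fun i => by have := h.p_ne i; field_simp)
  have kQ : ∀ t, br (fun i => p i - Complex.I * a) t
      = (a * (a - α)) * br (fun i => 1 / (p' i + Complex.I * a)) t + 0 * br p t :=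
    fun t => bracket_left_comb _ c d _ _ _ fun i => by
      have := h.q'_ne i
      field_simp
      linear_combination h.mul_eq i
  have kP : ∀ t, br (fun i => (p i - Complex.I * a) / p i) t
      = 1 * br (fun _ => 1) t + (-(Complex.I * a)) * br (fun i => 1 / p i) t :=
    fun t => bracket_left_comb _ c d _ _ _ fun i => by
      have := h.p_ne i
      field_simp
      ring
  have kZ : br (fun i => (p i - Complex.I * a) / p i) (fun _ => 1)
      = -Complex.I * (a - α) * br (fun i => 1 / (p' i + Complex.I * α)) (fun _ => 1)
        + 0 * br p (fun _ => 1) :=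
    bracket_left_comb _ c d _ _ _ fun i => by
      have := h.b'_ne i
      have := h.p_ne i
      field_simp
      linear_combination h.q_mul_b' i
  have k1 : br (fun i => (p i - Complex.I * a) / p i) (fun i => (p i - p' i) * (1 / p i))
      = 1 * br (fun i => (p i - Complex.I * a) / p i) (fun _ => 1)
        + (-1) * br (fun i => (p i - Complex.I * a) / p i) (fun i => p' i / p i) :=
    bracket_right_comb _ c d _ _ _ fun i => by
      have := h.p_ne i
      field_simp
      ring
  have k2 : br (fun i => (p i - Complex.I * a) / p i) (fun i => p' i / p i)
      = (-Complex.I * α) * br (fun i => (p i - Complex.I * a) / p i) (fun i => 1 / p i)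
        + (-Complex.I * (a - α)) * br (fun i => (p i - Complex.I * a) / p i)
          (fun i => 1 / (p i - Complex.I * a)) :=
    bracket_right_comb _ c d _ _ _ fun i => by
      have := h.p_ne i
      have := h.q_ne i
      field_simp
      linear_combination h.mul_eq i + a * (a - α) * Complex.I_sq
  have k3 : br (fun i => (p i - p' i) * ((p i - Complex.I * a) / p i)) (fun i => 1 / p i)
      = 1 * br (fun i => p i - Complex.I * a) (fun i => 1 / p i)
        + (-1) * br (fun i => p' i * (p i - Complex.I * a) / p i) (fun i => 1 / p i) :=
    bracket_left_comb _ c d _ _ _ fun i => by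
      have := h.p_ne i
      field_simp
      ring
  have k4 : br (fun i => p' i * (p i - Complex.I * a) / p i) (fun i => 1 / p i)
      = (-(Complex.I * a)) * br (fun _ => 1) (fun i => 1 / p i)
        + (-(a * α)) * br (fun i => 1 / p i) (fun i => 1 / p i) :=
    bracket_left_comb _ c d _ _ _ fun i => by
      have := h.p_ne i
      field_simp
      linear_combination h.mul_eq i + a ^ 2 * Complex.I_sq
  have kW := kP (fun _ => 1)
  rw [k1, k2, k3, k4, s1, s2, s3, kZ, kP, kQ, kQ] at k
  rw [kZ] at kW
  clear_value br
  -- The commutator yields the identity only after multiplication by `a - α`.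
  refine (mul_eq_zero.mp ?_).resolve_left h.sub_ne
  linear_combination Complex.I * a * k - Complex.I * (a - α) * kW
    + ((a ^ 2 - a * α) * br (fun _ => 1) (fun i => 1 / p i)
      + (a * α - α ^ 2) * br (fun i => 1 / (p' i + Complex.I * α)) (fun _ => 1)
      + a ^ 2 * (a - α) * (br (fun i => 1 / (p' i + Complex.I * a)) (fun _ => 1)
          * br (fun _ => 1) (fun i => 1 / p i)
        - br (fun i => 1 / (p' i + Complex.I * a)) (fun i => 1 / p i)
          * br (fun _ => 1) (fun _ => 1))
      + a ^ 2 * α * Complex.I * br (fun i => 1 / p i) (fun i => 1 / p i)) * Complex.I_sq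

end IsCircular
end Dressing
-- Nonvanishing of `f`.
section Nonvanishing

variable {n : Type*} [Fintype n]

/-- For a Hermitian `M` such that `R M + Q M Q` has rank one, where `Q = P - ia` and `Q Q* = R`,
the map `M` sends the kernel of `1 + i P M` to the kernel of `1 - i P* M`. -/
theorem conj_mul_eq_of_displacement {M : Matrix n n ℂ} {p u w y z : n → ℂ} {a R η : ℝ}
    (hM : ∀ i j, conj (M i j) = M j i) (hR : R ≠ 0) (hη : η ≠ 0)
    (hq : ∀ i, (p i - Complex.I * a) * (conj (p i) + Complex.I * a) = R)
    (hrank : ∀ i j, R * M i j + (p i - Complex.I * a) * M i j * (p j - Complex.I * a)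
      = η * (u i * (conj (u j) * (p j - Complex.I * a))))
    (hy : ∀ i, y i = ∑ j, M i j * w j) (hz : ∀ i, z i = ∑ j, M i j * y j)
    (hw : ∀ i, w i = -Complex.I * p i * y i) (i : n) :
    conj (p i) * z i + Complex.I * y i = 0 := by
  have hRc : (R : ℂ) ≠ 0 := by exact_mod_cast hR
  have hηc : (η : ℂ) ≠ 0 := by exact_mod_cast hη
  set β : ℂ := ∑ j, conj (u j) * (p j - Complex.I * a) * y j with hβ
  -- The displacement identity applied to `y`, using `Qy = iw - iay` and hence `MQy = iy - iaz`.
  have h1 : ∀ i, R * z i + (p i - Complex.I * a) * (Complex.I * y i - Complex.I * a * z i)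
      = η * u i * β := by
    intro i
    have hqy : ∀ j, (p j - Complex.I * a) * y j = Complex.I * w j - Complex.I * a * y j := by
      intro j
      rw [hw j]
      linear_combination p j * y j * Complex.I_sq
    rw [hβ, Finset.mul_sum]
    calc R * z i + (p i - Complex.I * a) * (Complex.I * y i - Complex.I * a * z i)
        = ∑ j, (R * M i j * y j + (p i - Complex.I * a) * (M i j * (Complex.I * w j
            - Complex.I * a * y j))) := by
          rw [Finset.sum_add_distrib, ← Finset.mul_sum]
          simp only [mul_sub, Finset.sum_sub_distrib]
          have e1 : ∑ j, (R : ℂ) * M i j * y j = R * z i := by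
            rw [hz, Finset.mul_sum]
            exact Finset.sum_congr rfl fun j _ => by ring
          have e2 : ∑ j, M i j * (Complex.I * w j) = Complex.I * y i := by
            rw [hy, Finset.mul_sum]
            exact Finset.sum_congr rfl fun j _ => by ring
          have e3 : ∑ j, M i j * (Complex.I * a * y j) = Complex.I * a * z i := by
            rw [hz, Finset.mul_sum]
            exact Finset.sum_congr rfl fun j _ => by ring
          rw [e1, e2, e3]
      _ = _ := by
          refine Finset.sum_congr rfl fun j _ => ?_
          rw [← hqy j]
          linear_combination y j * hrank i j
  have h2 : ∀ i, R * (conj (p i) * z i + Complex.I * y i)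
      = η * (conj (p i) + Complex.I * a) * u i * β := by
    intro i
    linear_combination (conj (p i) + Complex.I * a) * h1 i
      - (Complex.I * y i - Complex.I * a * z i) * hq i
  -- Hermitian symmetry moves `M` across the pairing of `w` with `My`, giving `∑ |y_i|²`.
  have h3 : ∑ i, conj (y i) * (conj (p i) * z i + Complex.I * y i) = 0 := by
    have e1 : ∀ i, conj (y i) * (conj (p i) * z i + Complex.I * y i)
        = Complex.I * (conj (y i) * y i) - Complex.I * (conj (w i) * z i) := by
      intro i
      rw [hw i]
      simp only [map_mul, map_neg, Complex.conj_I]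
      linear_combination conj (p i) * conj (y i) * z i * Complex.I_sq
    have e2 : ∑ i, conj (w i) * z i = ∑ i, conj (y i) * y i := by
      calc ∑ i, conj (w i) * z i = ∑ i, ∑ j, conj (w i) * (M i j * y j) := by
            refine Finset.sum_congr rfl fun i _ => ?_
            rw [hz, Finset.mul_sum]
        _ = ∑ j, ∑ i, conj (w i) * (M i j * y j) := Finset.sum_comm
        _ = _ := by
            refine Finset.sum_congr rfl fun j _ => ?_
            nth_rewrite 2 [hy j]
            rw [map_sum, Finset.sum_mul]
            refine Finset.sum_congr rfl fun i _ => ?_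
            rw [map_mul, hM j i]
            ring
    simp only [e1, Finset.sum_sub_distrib, ← Finset.mul_sum, e2, sub_self]
  -- Pairing `h2` with `y` gives `η|β|²` on the right, while `h3` kills the left.
  have h4 : conj β * β = 0 := by
    have e1 : (R : ℂ) * ∑ i, conj (y i) * (conj (p i) * z i + Complex.I * y i)
        = η * (conj β * β) := by
      rw [hβ, map_sum, Finset.sum_mul, Finset.mul_sum, Finset.mul_sum, ← hβ]
      refine Finset.sum_congr rfl fun i _ => ?_
      have := h2 i
      simp only [map_mul, map_sub, Complex.conj_conj, Complex.conj_I, Complex.conj_ofReal]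
      linear_combination conj (y i) * this
    rw [h3, mul_zero] at e1
    exact (mul_eq_zero.mp e1.symm).resolve_left hηc
  have h5 : β = 0 := by
    rcases mul_eq_zero.mp h4 with h | h
    · exact (map_eq_zero _).mp h
    · exact h
  have h6 := h2 i
  rw [h5, mul_zero] at h6
  exact (mul_eq_zero.mp h6).resolve_left hRc

variable [DecidableEq n] {p c : n → ℂ} {a α : ℝ}

theorem dressing_mulVec_eq_zero_iff (w : n → ℂ) :
    (dressing p (fun i => conj (p i)) c (fun i => conj (c i))).mulVec w = 0
      ↔ ∀ i, w i = -Complex.I * p i * ∑ j, c i * conj (c j) / (p i + conj (p j)) * w j := by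
  rw [funext_iff]
  refine forall_congr' fun i => ?_
  have h : (dressing p (fun i => conj (p i)) c (fun i => conj (c i))).mulVec w i
      = w i + Complex.I * p i * ∑ j, c i * conj (c j) / (p i + conj (p j)) * w j := by
    simp only [Matrix.mulVec, dotProduct, dressing, Matrix.of_apply, add_mul, ite_mul, one_mul,
      zero_mul, Finset.sum_add_distrib, Finset.sum_ite_eq, Finset.mem_univ, if_true,
      Finset.mul_sum]
    congr 1
    refine Finset.sum_congr rfl fun j _ => ?_
    ring
  rw [h, Pi.zero_apply]
  constructor <;> intro h' <;> linear_combination h'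

/-- Two uses of `conj_mul_eq_of_displacement` show that `M²` preserves the kernel, and on the kernel
`M²` acts as `diag(1/|p|²)`. -/
theorem dressing_mulVec_div_norm_sq (h : IsCircular (a : ℂ) (α : ℂ) p (fun i => conj (p i)))
    {w : n → ℂ} (hw : (dressing p (fun i => conj (p i)) c (fun i => conj (c i))).mulVec w = 0) :
    (dressing p (fun i => conj (p i)) c (fun i => conj (c i))).mulVec
      (fun i => w i / (p i * conj (p i))) = 0 := by
  rw [dressing_mulVec_eq_zero_iff] at hw ⊢
  set M : Matrix n n ℂ := Matrix.of fun i j => c i * conj (c j) / (p i + conj (p j)) with hMdef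
  have hM : ∀ i j, conj (M i j) = M j i := by
    intro i j
    simp only [hMdef, Matrix.of_apply, map_div₀, map_mul, map_add, Complex.conj_conj]
    rw [mul_comm, add_comm]
  set R : ℝ := a * (a - α) with hR
  have hRc : (R : ℂ) = a * (a - α) := by rw [hR]; push_cast; ring
  have hR0 : R ≠ 0 := by
    have := mul_ne_zero h.a_ne h.sub_ne
    rw [← hRc] at this
    exact_mod_cast this
  have hq : ∀ i, (p i - Complex.I * a) * (conj (p i) + Complex.I * a) = R :=
    fun i => (h.mul_eq i).trans hRc.symm
  set y : n → ℂ := fun i => ∑ j, M i j * w j with hy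
  set z : n → ℂ := fun i => ∑ j, M i j * y j with hz
  have h1 : ∀ i, conj (p i) * z i + Complex.I * y i = 0 := by
    refine conj_mul_eq_of_displacement (u := c) (η := 1) hM hR0 one_ne_zero hq ?_
      (fun i => rfl) (fun i => rfl) hw
    intro i j
    have := h.add_ne i j
    simp only [hMdef, Matrix.of_apply]
    field_simp
    push_cast
    linear_combination -c i * conj (c j) * hq j
  have h2 : ∀ i, conj (conj (p i)) * (∑ j, M i j * z j) + Complex.I * (-z i) = 0 := by
    -- The conjugate problem: `1 - iP*M = 1 + iP*(-M)`, where `p*` satisfies the constraint with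
    -- `-a` in place of `a`.
    refine conj_mul_eq_of_displacement (M := -M) (p := fun i => conj (p i)) (w := y)
      (u := fun i => (conj (p i) + Complex.I * a) * c i) (η := -R⁻¹) (a := -a) (R := R)
      (fun i j => by simp [hM]) hR0 (by simpa using hR0) ?_ ?_ ?_ ?_ ?_
    · intro i
      rw [← hq i, Complex.conj_conj]
      push_cast
      ring
    · intro i j
      have h3 := h.add_ne i j
      have hRc0 : (R : ℂ) ≠ 0 := by exact_mod_cast hR0
      simp only [hMdef, Matrix.of_apply, Matrix.neg_apply, map_mul, map_add, Complex.conj_conj,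
        Complex.conj_I, Complex.conj_ofReal]
      push_cast
      field_simp
      linear_combination c i * conj (c j) * (R * hq i
        + (conj (p i) + Complex.I * a) * (p i + conj (p j)) * hq j)
    · intro i
      simp [hz]
    · intro i
      simp
    · intro i
      linear_combination -Complex.I * h1 i + y i * Complex.I_sq
  have h3 : ∀ i, w i / (p i * conj (p i)) = z i := by
    intro i
    have e1 := h.p_ne i
    have e2 := h.p'_ne i
    rw [div_eq_iff (mul_ne_zero e1 e2), hw i]
    change -Complex.I * p i * y i = _
    linear_combination -p i * h1 i
  intro i
  simp only [h3]
  have := h2 i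
  rw [Complex.conj_conj] at this
  change _ = -Complex.I * p i * (∑ j, M i j * z j)
  linear_combination Complex.I * this + z i * Complex.I_sq

theorem det_dressing_ne_zero (h : IsCircular (a : ℂ) (α : ℂ) p (fun i => conj (p i)))
    (hc : ∀ i, c i ≠ 0) :
    (dressing p (fun i => conj (p i)) c (fun i => conj (c i))).det ≠ 0 := by
  intro hdet
  set A := dressing p (fun i => conj (p i)) c (fun i => conj (c i)) with hA
  obtain ⟨w₀, hw₀, hAw₀⟩ := Matrix.exists_mulVec_eq_zero_iff.mpr hdet
  let V : Submodule ℂ (n → ℂ) := LinearMap.ker A.mulVecLin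
  let D : Module.End ℂ (n → ℂ) :=
    (Matrix.diagonal fun i => (p i * conj (p i))⁻¹).mulVecLin
  have hD : ∀ w i, D w i = w i / (p i * conj (p i)) := by
    intro w i
    simp only [D, Matrix.mulVecLin_apply, Matrix.mulVec_diagonal]
    rw [mul_comm, div_eq_mul_inv]
  have hDV : ∀ w ∈ V, D w ∈ V := by
    intro w hw
    have : D w = fun i => w i / (p i * conj (p i)) := funext (hD w)
    rw [this]
    exact dressing_mulVec_div_norm_sq h hw
  have : Nontrivial V := ⟨⟨⟨w₀, hAw₀⟩, 0, fun e => hw₀ (congrArg Subtype.val e)⟩⟩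
  obtain ⟨μ, hμ⟩ := Module.End.exists_eigenvalue (LinearMap.restrict D hDV)
  obtain ⟨⟨w, hwV⟩, hw⟩ := hμ.exists_hasEigenvector
  have hw0 : w ≠ 0 := fun e => hw.2 (Subtype.ext e)
  have hwμ : ∀ i, w i / (p i * conj (p i)) = μ * w i := by
    intro i
    have := congrFun (congrArg Subtype.val hw.apply_eq_smul) i
    simpa [hD] using this
  obtain ⟨k, hk⟩ := Function.ne_iff.mp hw0
  rw [Pi.zero_apply] at hk
  -- The eigenvalue fixes `|p_i|²` on the support of `w`, and on the circle this fixes `p_i`.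
  have hpk : ∀ i, w i ≠ 0 → p i = p k := by
    have e : ∀ i, w i ≠ 0 → μ * (p i * conj (p i)) = 1 := by
      intro i hi
      have e1 := h.p_ne i
      have e2 := h.p'_ne i
      have e3 := hwμ i
      rw [div_eq_iff (mul_ne_zero e1 e2)] at e3
      exact mul_left_cancel₀ hi (by linear_combination -e3)
    intro i hi
    have hμ0 : μ ≠ 0 := left_ne_zero_of_mul (e k hk ▸ one_ne_zero)
    exact h.eq_of_mul_eq (mul_left_cancel₀ hμ0 ((e i hi).trans (e k hk).symm))
  have hwV' := (dressing_mulVec_eq_zero_iff w).mp hwV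
  set S : ℂ := ∑ j, conj (c j) * w j with hS
  have h1 : ∀ i, w i ≠ 0 → w i * (p k + conj (p k)) = -Complex.I * p k * c i * S := by
    intro i hi
    have hk' := h.add_ne k k
    rw [hwV' i, hpk i hi, hS, Finset.mul_sum, Finset.mul_sum, Finset.sum_mul]
    refine Finset.sum_congr rfl fun j _ => ?_
    rcases eq_or_ne (w j) 0 with hj | hj
    · simp [hj]
    · rw [hpk j hj]
      field_simp
  have hS0 : S ≠ 0 := by
    intro hS0
    have := h1 k hk
    rw [hS0, mul_zero] at this
    exact mul_ne_zero hk (h.add_ne k k) this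
  clear_value S
  have h2 : S * (p k + conj (p k))
      = -Complex.I * p k * (∑ i with w i ≠ 0, conj (c i) * c i) * S := by
    have e1 : S = ∑ i with w i ≠ 0, conj (c i) * w i := by
      rw [hS, Finset.sum_filter]
      refine Finset.sum_congr rfl fun i _ => ?_
      by_cases hi : w i = 0 <;> simp [hi]
    nth_rewrite 1 [e1]
    rw [Finset.sum_mul, Finset.mul_sum, Finset.sum_mul]
    refine Finset.sum_congr rfl fun i hi => ?_
    linear_combination conj (c i) * h1 i (Finset.mem_filter.mp hi).2
  have h3 : p k + conj (p k) = -Complex.I * p k * (∑ i with w i ≠ 0, conj (c i) * c i) :=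
    mul_right_cancel₀ hS0 (by linear_combination h2)
  have h4 : (∑ i with w i ≠ 0, conj (c i) * c i)
      = ((∑ i with w i ≠ 0, Complex.normSq (c i) : ℝ) : ℂ) := by
    push_cast
    exact Finset.sum_congr rfl fun i _ => by rw [Complex.normSq_eq_conj_mul_self]
  have h5 : 0 < ∑ i with w i ≠ 0, Complex.normSq (c i) :=
    Finset.sum_pos (fun i _ => Complex.normSq_pos.mpr (hc i))
      ⟨k, Finset.mem_filter.mpr ⟨Finset.mem_univ k, hk⟩⟩
  rw [h4] at h3
  -- The left side is real, while the right side has imaginary part `-Re p_k ∑ |c_i|²`.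
  have h6 := congrArg Complex.im h3
  simp at h6
  have h7 : (p k).re ≠ 0 := by
    intro e
    refine h.add_ne k k (Complex.ext ?_ ?_) <;> simp [e]
  rcases h6 with h6 | h6
  · exact h7 h6
  · simp only [ne_eq] at h5
    exact h5.ne' h6

end Nonvanishing
-- Tau functions as rank-one perturbations of `f`.
section Tau

variable {n : Type*} [Fintype n] [DecidableEq n] {p p' c d : n → ℂ}

theorem det_dressing_sub_const (hadd : ∀ i j, p i + p' j ≠ 0)
    (hA : (dressing p p' c d).det ≠ 0) :
    (Matrix.of fun i j => (if i = j then (1 : ℂ) else 0)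
      - Complex.I * p' j / (p i + p' j) * (c i * d j)).det
    = (dressing p p' c d).det
      * (1 - Complex.I * bracket (dressing p p' c d) c d (fun _ => 1) (fun _ => 1)) := by
  have h := det_add_rank_one hA c d (fun _ => -Complex.I) (fun _ => 1)
  rw [bracket_right_comb _ c d _ (t₁ := fun _ => 1) (t₂ := fun _ => 1) (-Complex.I) 0
    (fun i => by ring)] at h
  rw [show (1 - Complex.I * bracket (dressing p p' c d) c d (fun _ => 1) (fun _ => 1))
    = 1 + (-Complex.I * bracket (dressing p p' c d) c d (fun _ => 1) (fun _ => 1)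
      + 0 * bracket (dressing p p' c d) c d (fun _ => 1) (fun _ => 1)) by ring, ← h]
  congr 1
  ext i j
  have := hadd i j
  simp only [dressing, Matrix.of_apply]
  field_simp
  ring

/-- As `p'_j(p_i - ib) - p_i(p'_j + ib) = -ib(p_i + p'_j)`, the entries differ from those of `A` by
`b/(p'_j + ib)` times `c_i d_j`. -/
theorem det_dressing_shift (hadd : ∀ i j, p i + p' j ≠ 0) {b : ℂ}
    (hb : ∀ j, p' j + Complex.I * b ≠ 0) (hA : (dressing p p' c d).det ≠ 0) :
    (Matrix.of fun i j => (if i = j then (1 : ℂ) else 0)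
      + -Complex.I * p' j / (p i + p' j) * (-((p i - Complex.I * b) / (p' j + Complex.I * b)))
        * (c i * d j)).det
    = (dressing p p' c d).det * (1 + b * bracket (dressing p p' c d) c d
        (fun i => 1 / (p' i + Complex.I * b)) (fun _ => 1)) := by
  have h := det_add_rank_one hA c d (fun _ => b) (fun i => 1 / (p' i + Complex.I * b))
  rw [bracket_right_comb _ c d _ (t₁ := fun _ => 1) (t₂ := fun _ => 1) b 0
    (fun i => by ring), zero_mul, add_zero] at h
  rw [← h]
  congr 1
  ext i j
  have := hadd i j
  have := hb j
  simp only [dressing, Matrix.of_apply]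
  field_simp
  linear_combination -b * (p i + p' j) * c i * d j * Complex.I_sq

/-- The form taken by `g*` and `h*`: conjugation moves the shift from the column index to the row
index. -/
theorem det_dressing_shift' (hadd : ∀ i j, p i + p' j ≠ 0) {b : ℂ}
    (hb : ∀ i, p i - Complex.I * b ≠ 0) (hA : (dressing p p' c d).det ≠ 0) :
    (Matrix.of fun i j => (if i = j then (1 : ℂ) else 0)
      + Complex.I * p i / (p i + p' j) * (-((p' j + Complex.I * b) / (p i - Complex.I * b)))
        * (c i * d j)).det
    = (dressing p p' c d).det * (1 - Complex.I * bracket (dressing p p' c d) c d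
        (fun _ => 1) (fun i => p i / (p i - Complex.I * b))) := by
  have h := det_add_rank_one hA c d (fun i => -Complex.I * (p i / (p i - Complex.I * b)))
    (fun _ => 1)
  rw [bracket_right_comb _ c d _ (t₁ := fun i => p i / (p i - Complex.I * b))
    (t₂ := fun _ => 1) (-Complex.I) 0 (fun i => by ring), zero_mul, add_zero] at h
  rw [sub_eq_add_neg, ← neg_mul, ← h]
  congr 1
  ext i j
  have := hadd i j
  have := hb i
  simp only [dressing, Matrix.of_apply]
  field_simp
  ring

theorem conj_det (A : Matrix n n ℂ) : conj A.det = (Matrix.of fun i j => conj (A j i)).det := by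
  rw [starRingEnd_apply, ← Matrix.det_conjTranspose]
  congr 1

theorem contDiff_det {E : Type*} [NormedAddCommGroup E] [NormedSpace ℝ E] {k : ℕ∞}
    {A : E → Matrix n n ℂ} (hA : ∀ i j, ContDiff ℝ k fun z => A z i j) :
    ContDiff ℝ k fun z => (A z).det := by
  simp only [Matrix.det_apply']
  exact ContDiff.sum fun τ _ => contDiff_const.mul (contDiff_prod fun i _ => hA _ _)

end Tau

/-! ### Exponentials, phase and their derivatives. -/

section Soliton

variable {N : ℕ} {σ ρ₁ ρ₂ α : ℝ} {p ξ₀ : Fin N → ℂ}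

/-- The exponential `e^{ξ_i}`. -/
def wave (σ ρ₁ ρ₂ α : ℝ) (p ξ₀ : Fin N → ℂ) (x t : ℝ) (i : Fin N) : ℂ :=
  Complex.exp (xi σ ρ₁ ρ₂ α (p i) (ξ₀ i) x t)

/-- The conjugate exponential `e^{ξ_i*}`. -/
def waveConj (σ ρ₁ ρ₂ α : ℝ) (p ξ₀ : Fin N → ℂ) (x t : ℝ) (i : Fin N) : ℂ :=
  conj (wave σ ρ₁ ρ₂ α p ξ₀ x t i)

/-- The matrix whose determinant is `f`. -/
def tauMatrix (σ ρ₁ ρ₂ α : ℝ) (p ξ₀ : Fin N → ℂ) (x t : ℝ) : Matrix (Fin N) (Fin N) ℂ :=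
  dressing p (fun i => conj (p i)) (wave σ ρ₁ ρ₂ α p ξ₀ x t) (waveConj σ ρ₁ ρ₂ α p ξ₀ x t)

/-- The bracket of `tauMatrix`. -/
def tauBracket (σ ρ₁ ρ₂ α : ℝ) (p ξ₀ : Fin N → ℂ) (x t : ℝ) (S T : Fin N → ℂ) : ℂ :=
  bracket (tauMatrix σ ρ₁ ρ₂ α p ξ₀ x t) (wave σ ρ₁ ρ₂ α p ξ₀ x t)
    (waveConj σ ρ₁ ρ₂ α p ξ₀ x t) S T

theorem wave_ne_zero (x t : ℝ) (i : Fin N) : wave σ ρ₁ ρ₂ α p ξ₀ x t i ≠ 0 :=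
  Complex.exp_ne_zero _

theorem expFactor_eq (x t : ℝ) (i j : Fin N) :
    expFactor σ ρ₁ ρ₂ α p ξ₀ x t i j
      = wave σ ρ₁ ρ₂ α p ξ₀ x t i * waveConj σ ρ₁ ρ₂ α p ξ₀ x t j := by
  rw [expFactor, Complex.exp_add, wave, waveConj, wave, ← Complex.exp_conj]

theorem tauF_eq (x t : ℝ) :
    tauF σ ρ₁ ρ₂ α p ξ₀ x t = (tauMatrix σ ρ₁ ρ₂ α p ξ₀ x t).det := by
  simp only [tauF, tauMatrix, dressing, expFactor_eq]

theorem conj_expFactor (x t : ℝ) (i j : Fin N) :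
    conj (expFactor σ ρ₁ ρ₂ α p ξ₀ x t i j) = expFactor σ ρ₁ ρ₂ α p ξ₀ x t j i := by
  simp only [expFactor, ← Complex.exp_conj, map_add, Complex.conj_conj, add_comm]

theorem conj_tauF (x t : ℝ) :
    conj (tauF σ ρ₁ ρ₂ α p ξ₀ x t) = tauFStar σ ρ₁ ρ₂ α p ξ₀ x t := by
  rw [tauF, tauFStar, conj_det]
  congr 1
  ext i j
  simp only [Matrix.of_apply, map_add, map_mul, map_div₀, conj_expFactor, Complex.conj_I,
    Complex.conj_conj, apply_ite conj, map_one, map_zero, eq_comm (a := j), add_comm (conj (p j))]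
  ring

theorem hasDerivAt_wave_x (x t : ℝ) (i : Fin N) :
    HasDerivAt (fun y => wave σ ρ₁ ρ₂ α p ξ₀ y t i)
      ((ρ₂ : ℂ) / (α * ρ₁) * p i * wave σ ρ₁ ρ₂ α p ξ₀ x t i) x := by
  have h : HasDerivAt (fun y : ℝ => xi σ ρ₁ ρ₂ α (p i) (ξ₀ i) y t)
      ((ρ₂ : ℂ) / (α * ρ₁) * p i * 1) x := by
    simp only [xi]
    exact (((HasDerivAt.ofReal_comp (hasDerivAt_id x)).const_mul _).sub_const _).add_const _
  exact h.cexp.congr_deriv (by rw [wave]; ring)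

theorem hasDerivAt_wave_t (x t : ℝ) (i : Fin N) :
    HasDerivAt (fun s => wave σ ρ₁ ρ₂ α p ξ₀ x s i)
      (-((ρ₁ : ℂ) * α * (1 + σ * ρ₁ * ρ₂) / ρ₂) * (1 / p i) * wave σ ρ₁ ρ₂ α p ξ₀ x t i) t := by
  have h : HasDerivAt (fun s : ℝ => xi σ ρ₁ ρ₂ α (p i) (ξ₀ i) x s)
      (-((ρ₁ : ℂ) * α * (1 + σ * ρ₁ * ρ₂) / ρ₂ * (1 / p i))) t := by
    simp only [xi]
    exact ((((HasDerivAt.ofReal_comp (hasDerivAt_id t)).div_const (p i)).const_mul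
      ((ρ₁ : ℂ) * α * (1 + σ * ρ₁ * ρ₂) / ρ₂)).const_sub _).add_const _
  exact h.cexp.congr_deriv (by rw [wave]; ring)

theorem hasDerivAt_waveConj_x (x t : ℝ) (i : Fin N) :
    HasDerivAt (fun y => waveConj σ ρ₁ ρ₂ α p ξ₀ y t i)
      ((ρ₂ : ℂ) / (α * ρ₁) * conj (p i) * waveConj σ ρ₁ ρ₂ α p ξ₀ x t i) x := by
  refine (hasDerivAt_wave_x x t i).star.congr_deriv ?_
  simp [waveConj]

theorem hasDerivAt_waveConj_t (x t : ℝ) (i : Fin N) :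
    HasDerivAt (fun s => waveConj σ ρ₁ ρ₂ α p ξ₀ x s i)
      (-((ρ₁ : ℂ) * α * (1 + σ * ρ₁ * ρ₂) / ρ₂) * (1 / conj (p i))
        * waveConj σ ρ₁ ρ₂ α p ξ₀ x t i) t := by
  refine (hasDerivAt_wave_t x t i).star.congr_deriv ?_
  simp [waveConj]

/-- Differentiating `c_i d_j` produces a constant times `p_i + p_j*`, which cancels the denominator.
-/
theorem hasDerivAt_tauBracket_x (hp : ∀ i j, p i + conj (p j) ≠ 0)
    (hdet : ∀ x t, (tauMatrix σ ρ₁ ρ₂ α p ξ₀ x t).det ≠ 0) (x t : ℝ) (S T : Fin N → ℂ) :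
    HasDerivAt (fun y => tauBracket σ ρ₁ ρ₂ α p ξ₀ y t S T)
      ((ρ₂ : ℂ) / (α * ρ₁) * (tauBracket σ ρ₁ ρ₂ α p ξ₀ x t (fun i => conj (p i) * S i) T
        + tauBracket σ ρ₁ ρ₂ α p ξ₀ x t S (fun i => p i * T i)
        - Complex.I * tauBracket σ ρ₁ ρ₂ α p ξ₀ x t S p
          * tauBracket σ ρ₁ ρ₂ α p ξ₀ x t (fun _ => 1) T)) x := by
  refine (hasDerivAt_bracket (A := fun y => tauMatrix σ ρ₁ ρ₂ α p ξ₀ y t)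
    (r := fun i => (ρ₂ : ℂ) / (α * ρ₁) * Complex.I * p i) (s := fun _ => 1)
    (fun y => hdet y t) ?_
    (hasDerivAt_wave_x x t) (hasDerivAt_waveConj_x x t) S T).congr_deriv ?_
  · intro i j
    have := hp i j
    refine ((((hasDerivAt_wave_x x t i).mul (hasDerivAt_waveConj_x x t j)).const_mul
      (Complex.I * p i / (p i + conj (p j)))).const_add _).congr_deriv ?_
    field_simp
  · rw [bracket_left_comb _ _ _ (s₁ := fun i => conj (p i) * S i) (s₂ := S) _
        ((ρ₂ : ℂ) / (α * ρ₁)) 0 (fun i => by ring),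
      bracket_right_comb _ _ _ S (t₁ := fun i => p i * T i) (t₂ := S)
        (t := fun i => (ρ₂ : ℂ) / (α * ρ₁) * p i * T i)
        ((ρ₂ : ℂ) / (α * ρ₁)) 0 (fun i => by ring),
      bracket_right_comb _ _ _ S (t₁ := p) (t₂ := S)
        (t := fun i => (ρ₂ : ℂ) / (α * ρ₁) * Complex.I * p i)
        ((ρ₂ : ℂ) / (α * ρ₁) * Complex.I) 0 (fun i => by ring)]
    simp only [tauBracket]
    ring

/-- Here the factor is `1/p_i + 1/p_j* = (p_i + p_j*)/(p_i p_j*)`, so `1/p_j*` survives. -/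
theorem hasDerivAt_tauBracket_t (hp : ∀ i j, p i + conj (p j) ≠ 0)
    (hdet : ∀ x t, (tauMatrix σ ρ₁ ρ₂ α p ξ₀ x t).det ≠ 0) (x t : ℝ) (S T : Fin N → ℂ) :
    HasDerivAt (fun s => tauBracket σ ρ₁ ρ₂ α p ξ₀ x s S T)
      (-((ρ₁ : ℂ) * α * (1 + σ * ρ₁ * ρ₂) / ρ₂)
        * (tauBracket σ ρ₁ ρ₂ α p ξ₀ x t (fun i => 1 / conj (p i) * S i) T
        + tauBracket σ ρ₁ ρ₂ α p ξ₀ x t S (fun i => 1 / p i * T i)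
        - Complex.I * tauBracket σ ρ₁ ρ₂ α p ξ₀ x t S (fun _ => 1)
          * tauBracket σ ρ₁ ρ₂ α p ξ₀ x t (fun i => 1 / conj (p i)) T)) t := by
  have hp0 : ∀ i, p i ≠ 0 := fun i e => hp i i (by simp [e])
  refine (hasDerivAt_bracket (A := fun s => tauMatrix σ ρ₁ ρ₂ α p ξ₀ x s)
    (r := fun i => -((ρ₁ : ℂ) * α * (1 + σ * ρ₁ * ρ₂) / ρ₂) * Complex.I)
    (s := fun i => 1 / conj (p i)) (fun s => hdet x s) ?_
    (hasDerivAt_wave_t x t) (hasDerivAt_waveConj_t x t) S T).congr_deriv ?_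
  · intro i j
    have := hp i j
    have := hp0 i
    have : conj (p j) ≠ 0 := (map_ne_zero _).mpr (hp0 j)
    refine ((((hasDerivAt_wave_t x t i).mul (hasDerivAt_waveConj_t x t j)).const_mul
      (Complex.I * p i / (p i + conj (p j)))).const_add _).congr_deriv ?_
    field_simp
    ring
  · rw [bracket_left_comb _ _ _ (s₁ := fun i => 1 / conj (p i) * S i) (s₂ := S) _
        (-((ρ₁ : ℂ) * α * (1 + σ * ρ₁ * ρ₂) / ρ₂)) 0 (fun i => by ring),
      bracket_right_comb _ _ _ S (t₁ := fun i => 1 / p i * T i) (t₂ := S)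
        (t := fun i => -((ρ₁ : ℂ) * α * (1 + σ * ρ₁ * ρ₂) / ρ₂) * (1 / p i) * T i)
        (-((ρ₁ : ℂ) * α * (1 + σ * ρ₁ * ρ₂) / ρ₂)) 0 (fun i => by ring),
      bracket_right_comb _ _ _ S (t₁ := fun _ => 1) (t₂ := S)
        (t := fun _ => -((ρ₁ : ℂ) * α * (1 + σ * ρ₁ * ρ₂) / ρ₂) * Complex.I)
        (-((ρ₁ : ℂ) * α * (1 + σ * ρ₁ * ρ₂) / ρ₂) * Complex.I) 0 (fun i => by ring)]
    simp only [tauBracket]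
    ring

theorem contDiff_expFactor (i j : Fin N) :
    ContDiff ℝ 1 fun z : ℝ × ℝ => expFactor σ ρ₁ ρ₂ α p ξ₀ z.1 z.2 i j := by
  have h1 : ContDiff ℝ 1 fun z : ℝ × ℝ => (z.1 : ℂ) := Complex.ofRealCLM.contDiff.comp contDiff_fst
  have h2 : ContDiff ℝ 1 fun z : ℝ × ℝ => (z.2 : ℂ) := Complex.ofRealCLM.contDiff.comp contDiff_snd
  have h3 : ∀ i, ContDiff ℝ 1 fun z : ℝ × ℝ => xi σ ρ₁ ρ₂ α (p i) (ξ₀ i) z.1 z.2 := fun i =>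
    ((contDiff_const.mul h1).sub (contDiff_const.mul (h2.div_const _))).add contDiff_const
  exact ((h3 i).add (Complex.conjCLE.contDiff.comp (h3 j))).cexp

theorem contDiff_phase : ContDiff ℝ 1 fun z : ℝ × ℝ => phase σ ρ₁ ρ₂ z.1 z.2 := by
  have h : ContDiff ℝ 1 fun z : ℝ × ℝ =>
      (1 + σ * ρ₁ * ρ₂) * (ρ₂ / ρ₁ * z.1 + ρ₁ / ρ₂ * z.2) := by fun_prop
  exact (contDiff_const.mul (Complex.ofRealCLM.contDiff.comp h)).cexp

theorem phase_mul_conj (x t : ℝ) : phase σ ρ₁ ρ₂ x t * conj (phase σ ρ₁ ρ₂ x t) = 1 := by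
  rw [phase, ← Complex.exp_conj, ← Complex.exp_add, map_mul, Complex.conj_I, Complex.conj_ofReal,
    neg_mul, add_neg_cancel, Complex.exp_zero]

theorem hasDerivAt_phase_x (x t : ℝ) :
    HasDerivAt (fun y => phase σ ρ₁ ρ₂ y t)
      (Complex.I * ((1 + σ * ρ₁ * ρ₂) * (ρ₂ / ρ₁)) * phase σ ρ₁ ρ₂ x t) x := by
  have h : HasDerivAt (fun y : ℝ => (1 + σ * ρ₁ * ρ₂) * (ρ₂ / ρ₁ * y + ρ₁ / ρ₂ * t))
      ((1 + σ * ρ₁ * ρ₂) * (ρ₂ / ρ₁ * 1)) x :=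
    (((hasDerivAt_id x).const_mul _).add_const _).const_mul _
  refine ((HasDerivAt.ofReal_comp h).const_mul Complex.I).cexp.congr_deriv ?_
  rw [phase]
  push_cast
  ring

theorem hasDerivAt_phase_t (x t : ℝ) :
    HasDerivAt (fun s => phase σ ρ₁ ρ₂ x s)
      (Complex.I * ((1 + σ * ρ₁ * ρ₂) * (ρ₁ / ρ₂)) * phase σ ρ₁ ρ₂ x t) t := by
  have h : HasDerivAt (fun s : ℝ => (1 + σ * ρ₁ * ρ₂) * (ρ₂ / ρ₁ * x + ρ₁ / ρ₂ * s))
      ((1 + σ * ρ₁ * ρ₂) * (ρ₁ / ρ₂ * 1)) t :=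
    (((hasDerivAt_id t).const_mul _).const_add _).const_mul _
  refine ((HasDerivAt.ofReal_comp h).const_mul Complex.I).cexp.congr_deriv ?_
  rw [phase]
  push_cast
  ring

end Soliton
-- Bilinear equations and assembly of the solution.
section Main

variable {N : ℕ} {σ ρ₁ ρ₂ α : ℝ} {p ξ₀ : Fin N → ℂ}

/-- The constraint on the spectral parameters puts them on a circle as in `IsCircular`. -/
theorem isCircular_of_constraint [Nonempty (Fin N)] (hσ : σ = 1 ∨ σ = -1)
    (hp : ∀ i j, p i + conj (p j) ≠ 0)
    (hconstraint : ∀ i,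
      (p i - Complex.I * α * (1 + σ * ρ₁ * ρ₂)) * (conj (p i) + Complex.I * α * (1 + σ * ρ₁ * ρ₂))
      = (α : ℂ) ^ 2 * ρ₁ * ρ₂ * (σ + ρ₁ * ρ₂)) :
    IsCircular ((α * (1 + σ * ρ₁ * ρ₂) : ℝ) : ℂ) (α : ℂ) p (fun i => conj (p i)) := by
  have hσ2 : (σ : ℂ) ^ 2 = 1 := by rcases hσ with h | h <;> simp [h]
  have hp0 : ∀ i, p i ≠ 0 := fun i e => hp i i (by simp [e])
  have hmul : ∀ i, (p i - Complex.I * ((α * (1 + σ * ρ₁ * ρ₂) : ℝ) : ℂ))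
      * (conj (p i) + Complex.I * ((α * (1 + σ * ρ₁ * ρ₂) : ℝ) : ℂ))
      = ((α * (1 + σ * ρ₁ * ρ₂) : ℝ) : ℂ) * (((α * (1 + σ * ρ₁ * ρ₂) : ℝ) : ℂ) - α) := by
    intro i
    push_cast
    linear_combination hconstraint i + (α : ℂ) ^ 2 * ρ₁ * ρ₂ * (-ρ₁ * ρ₂) * hσ2
  have hne : ((α * (1 + σ * ρ₁ * ρ₂) : ℝ) : ℂ) * (((α * (1 + σ * ρ₁ * ρ₂) : ℝ) : ℂ) - α) ≠ 0 := by
    obtain ⟨i⟩ := ‹Nonempty (Fin N)›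
    rw [← hmul i]
    have hre : (p i).re ≠ 0 := by
      intro e
      refine hp i i (Complex.ext ?_ ?_) <;> simp [e]
    -- Both factors have real part `Re p_i`.
    refine mul_ne_zero ?_ ?_ <;> intro e <;> exact hre (by simpa using congrArg Complex.re e)
  exact ⟨hp, hp0, fun i => (map_ne_zero _).mpr (hp0 i), left_ne_zero_of_mul hne,
    right_ne_zero_of_mul hne, hmul⟩

/-- Dictionary: `F`, `G`, `H`, `Ht` stand for `f*/f`, `g/f`, `h/f`, `h*/f`, and `E`, `Ec` for the
phase and its conjugate. -/
theorem thirring_eq_of_bilinear_x {s r₁ r₂ F G H G' F' Ht E Ec : ℂ} (hr₁ : r₁ ≠ 0)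
    (hF : F ≠ 0) (hE : E * Ec = 1)
    (h1 : Complex.I * G' = r₂ / r₁ * (G - H * F))
    (h2 : -Complex.I * F' = s * r₂ ^ 2 * (F - H * Ht)) :
    Complex.I * (r₁ * ((G' * F - G * F') / F ^ 2) * E
        + r₁ * (G / F) * (Complex.I * ((1 + s * r₁ * r₂) * (r₂ / r₁)) * E))
      + r₂ * H * E + s * (r₁ * (G / F) * E)
        * ((r₂ * H * E) * (r₂ * (Ht / F) * Ec)) = 0 := by
  have h1' : r₁ * (Complex.I * G') = r₂ * (G - H * F) := by
    rw [h1]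
    field_simp
  field_simp
  linear_combination E * (F * h1' + r₁ * G * h2 + s * r₁ * r₂ ^ 2 * G * H * Ht * hE
    + r₂ * (1 + s * r₁ * r₂) * G * F * Complex.I_sq)

theorem thirring_eq_of_bilinear_t {s r₁ r₂ F G H H' F' Gt E Ec : ℂ} (hr₂ : r₂ ≠ 0)
    (hF : F ≠ 0) (hE : E * Ec = 1)
    (h1 : Complex.I * (H' * F - H * F') = r₁ / r₂ * (H * F - G))
    (h2 : Complex.I * F' = s * r₁ ^ 2 * (F - G * Gt)) :
    Complex.I * (r₂ * H' * E + r₂ * H * (Complex.I * ((1 + s * r₁ * r₂) * (r₁ / r₂)) * E))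
      + r₁ * (G / F) * E + s * (r₂ * H * E)
        * ((r₁ * (G / F) * E) * (r₁ * Gt * Ec)) = 0 := by
  have h1' : r₂ * (Complex.I * (H' * F - H * F')) = r₁ * (H * F - G) := by
    rw [h1]
    field_simp
  field_simp
  linear_combination E * (h1' + r₂ * H * h2 + s * r₂ * r₁ ^ 2 * G * H * Gt * hE
    + r₁ * (1 + s * r₁ * r₂) * H * F * Complex.I_sq)

theorem contDiff_tauF : ContDiff ℝ 1 fun z : ℝ × ℝ => tauF σ ρ₁ ρ₂ α p ξ₀ z.1 z.2 := by
  refine contDiff_det (k := 1) fun i j => ?_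
  exact contDiff_const.add (contDiff_const.mul (contDiff_expFactor i j))

theorem contDiff_tauG : ContDiff ℝ 1 fun z : ℝ × ℝ => tauG σ ρ₁ ρ₂ α p ξ₀ z.1 z.2 := by
  refine contDiff_det (k := 1) fun i j => ?_
  exact contDiff_const.add (contDiff_const.mul (contDiff_expFactor i j))

theorem contDiff_tauH : ContDiff ℝ 1 fun z : ℝ × ℝ => tauH σ ρ₁ ρ₂ α p ξ₀ z.1 z.2 := by
  refine contDiff_det (k := 1) fun i j => ?_
  exact contDiff_const.add (contDiff_const.mul (contDiff_expFactor i j))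

theorem contDiff_darkU (hf : ∀ x t, tauF σ ρ₁ ρ₂ α p ξ₀ x t ≠ 0) :
    ContDiff ℝ 1 fun z : ℝ × ℝ => darkU σ ρ₁ ρ₂ α p ξ₀ z.1 z.2 := by
  have h : ContDiff ℝ 1 fun z : ℝ × ℝ => conj (tauF σ ρ₁ ρ₂ α p ξ₀ z.1 z.2) :=
    Complex.conjCLE.contDiff.comp contDiff_tauF
  simp only [darkU, div_eq_mul_inv]
  exact (contDiff_const.mul (contDiff_tauG.mul
    (h.inv fun z => (map_ne_zero _).mpr (hf z.1 z.2)))).mul contDiff_phase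

theorem contDiff_darkV (hf : ∀ x t, tauF σ ρ₁ ρ₂ α p ξ₀ x t ≠ 0) :
    ContDiff ℝ 1 fun z : ℝ × ℝ => darkV σ ρ₁ ρ₂ α p ξ₀ z.1 z.2 := by
  simp only [darkV, div_eq_mul_inv]
  exact (contDiff_const.mul (contDiff_tauH.mul
    (contDiff_tauF.inv fun z => hf z.1 z.2))).mul contDiff_phase

/-- The quotient `f*/f`. -/
def ratioF (σ ρ₁ ρ₂ α : ℝ) (p ξ₀ : Fin N → ℂ) (x t : ℝ) : ℂ :=
  1 - Complex.I * tauBracket σ ρ₁ ρ₂ α p ξ₀ x t (fun _ => 1) (fun _ => 1)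

/-- The quotient `g/f` for `b = α`, and `h/f` for `b = α (1 + σ ρ₁ ρ₂)`. -/
def ratioShift (σ ρ₁ ρ₂ α : ℝ) (p ξ₀ : Fin N → ℂ) (b : ℂ) (x t : ℝ) : ℂ :=
  1 + b * tauBracket σ ρ₁ ρ₂ α p ξ₀ x t (fun i => 1 / (conj (p i) + Complex.I * b)) (fun _ => 1)

/-- The quotient `g*/f` for `b = α`, and `h*/f` for `b = α (1 + σ ρ₁ ρ₂)`. -/
def ratioShiftStar (σ ρ₁ ρ₂ α : ℝ) (p ξ₀ : Fin N → ℂ) (b : ℂ) (x t : ℝ) : ℂ :=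
  1 - Complex.I * tauBracket σ ρ₁ ρ₂ α p ξ₀ x t (fun _ => 1) (fun i => p i / (p i - Complex.I * b))

/-- The equation for `G'` comes from `bracket_b'_p`, the one for `F'` from `bracket_identity_x`,
whose factor `a - α` turns `ρ₂/(αρ₁)` into `σρ₂²`. -/
theorem exists_hasDerivAt_ratio_x {a : ℂ} (hρ₁ : (ρ₁ : ℂ) ≠ 0)
    (ha : a = α * (1 + σ * ρ₁ * ρ₂)) (h : IsCircular a (α : ℂ) p (fun i => conj (p i)))
    (hdet : ∀ x t, (tauMatrix σ ρ₁ ρ₂ α p ξ₀ x t).det ≠ 0) (x t : ℝ) :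
    ∃ F' G' : ℂ, HasDerivAt (fun y => ratioF σ ρ₁ ρ₂ α p ξ₀ y t) F' x ∧
      HasDerivAt (fun y => ratioShift σ ρ₁ ρ₂ α p ξ₀ α y t) G' x ∧
      Complex.I * G' = ρ₂ / ρ₁ * (ratioShift σ ρ₁ ρ₂ α p ξ₀ α x t
        - ratioShift σ ρ₁ ρ₂ α p ξ₀ a x t * ratioF σ ρ₁ ρ₂ α p ξ₀ x t) ∧
      -Complex.I * F' = σ * ρ₂ ^ 2 * (ratioF σ ρ₁ ρ₂ α p ξ₀ x t
        - ratioShift σ ρ₁ ρ₂ α p ξ₀ a x t * ratioShiftStar σ ρ₁ ρ₂ α p ξ₀ a x t) := by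
  have hα : (α : ℂ) ≠ 0 := left_ne_zero_of_mul (ha ▸ h.a_ne)
  refine ⟨_, _, ((hasDerivAt_tauBracket_x h.add_ne hdet x t _ _).const_mul Complex.I).const_sub 1,
    ((hasDerivAt_tauBracket_x h.add_ne hdet x t _ _).const_mul (α : ℂ)).const_add 1, ?_, ?_⟩
  · set br := tauBracket σ ρ₁ ρ₂ α p ξ₀ x t
    have k : br (fun i => 1 / (conj (p i) + Complex.I * α)) p
        = Complex.I * a * br (fun i => 1 / (conj (p i) + Complex.I * a)) (fun _ => 1) :=
      h.bracket_b'_p (wave_ne_zero x t) (hdet x t)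
    have k1 : br (fun i => conj (p i) * (1 / (conj (p i) + Complex.I * α))) (fun _ => 1)
        = 1 * br (fun _ => 1) (fun _ => 1)
          + (-(Complex.I * α)) * br (fun i => 1 / (conj (p i) + Complex.I * α)) (fun _ => 1) :=
      bracket_left_comb _ _ _ _ _ _ fun i => by
        have := h.b'_ne i
        field_simp
        ring
    have hk : (ρ₂ : ℂ) / (α * ρ₁) * α = ρ₂ / ρ₁ := by field_simp
    have e1 : ratioF σ ρ₁ ρ₂ α p ξ₀ x t
      = 1 - Complex.I * br (fun _ => 1) (fun _ => 1) := rfl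
    have e2 : ∀ b, ratioShift σ ρ₁ ρ₂ α p ξ₀ b x t
      = 1 + b * br (fun i => 1 / (conj (p i) + Complex.I * b)) (fun _ => 1) := fun b => rfl
    clear_value br
    rw [e1, e2, e2, ← hk]
    simp only [mul_one]
    rw [k, k1]
    linear_combination ((ρ₂ : ℂ) / (α * ρ₁) * α)
      * (-α * br (fun i => 1 / (conj (p i) + Complex.I * α)) (fun _ => 1)
        + a * br (fun i => 1 / (conj (p i) + Complex.I * a)) (fun _ => 1)
        * (1 - Complex.I * br (fun _ => 1) (fun _ => 1))) * Complex.I_sq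
  · set br := tauBracket σ ρ₁ ρ₂ α p ξ₀ x t
    have k : (a - α) * (ratioF σ ρ₁ ρ₂ α p ξ₀ x t
        - ratioShift σ ρ₁ ρ₂ α p ξ₀ a x t * ratioShiftStar σ ρ₁ ρ₂ α p ξ₀ a x t)
        = -(br (fun i => conj (p i)) (fun _ => 1)
          + br (fun _ => 1) p * ratioF σ ρ₁ ρ₂ α p ξ₀ x t) :=
      h.bracket_identity_x (hdet x t)
    have hk : (ρ₂ : ℂ) / (α * ρ₁) * (a - α) = σ * ρ₂ ^ 2 := by
      rw [ha]
      field_simp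
      ring
    have e1 : ratioF σ ρ₁ ρ₂ α p ξ₀ x t
      = 1 - Complex.I * br (fun _ => 1) (fun _ => 1) := rfl
    clear_value br
    simp only [mul_one]
    rw [← hk]
    linear_combination (ρ₂ : ℂ) / (α * ρ₁) * (-k + br (fun _ => 1) p * e1
      + (br (fun i => conj (p i)) (fun _ => 1) + br (fun _ => 1) p
        - Complex.I * br (fun _ => 1) p * br (fun _ => 1) (fun _ => 1)) * Complex.I_sq)

theorem exists_hasDerivAt_ratio_t {a : ℂ} (hρ₂ : (ρ₂ : ℂ) ≠ 0)
    (ha : a = α * (1 + σ * ρ₁ * ρ₂)) (h : IsCircular a (α : ℂ) p (fun i => conj (p i)))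
    (hdet : ∀ x t, (tauMatrix σ ρ₁ ρ₂ α p ξ₀ x t).det ≠ 0) (x t : ℝ) :
    ∃ F' H' : ℂ, HasDerivAt (fun s => ratioF σ ρ₁ ρ₂ α p ξ₀ x s) F' t ∧
      HasDerivAt (fun s => ratioShift σ ρ₁ ρ₂ α p ξ₀ a x s) H' t ∧
      Complex.I * (H' * ratioF σ ρ₁ ρ₂ α p ξ₀ x t - ratioShift σ ρ₁ ρ₂ α p ξ₀ a x t * F')
        = ρ₁ / ρ₂ * (ratioShift σ ρ₁ ρ₂ α p ξ₀ a x t * ratioF σ ρ₁ ρ₂ α p ξ₀ x t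
          - ratioShift σ ρ₁ ρ₂ α p ξ₀ α x t) ∧
      Complex.I * F' = σ * ρ₁ ^ 2 * (ratioF σ ρ₁ ρ₂ α p ξ₀ x t
        - ratioShift σ ρ₁ ρ₂ α p ξ₀ α x t * ratioShiftStar σ ρ₁ ρ₂ α p ξ₀ α x t) := by
  have ha0 := h.a_ne
  have hα : (α : ℂ) ≠ 0 := left_ne_zero_of_mul (ha ▸ h.a_ne)
  have hl : (ρ₁ : ℂ) * α * (1 + σ * ρ₁ * ρ₂) / ρ₂ = ρ₁ / ρ₂ * a := by
    rw [ha]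
    ring
  refine ⟨_, _, ((hasDerivAt_tauBracket_t h.add_ne hdet x t _ _).const_mul Complex.I).const_sub 1,
    ((hasDerivAt_tauBracket_t h.add_ne hdet x t _ _).const_mul a).const_add 1, ?_, ?_⟩
  · set br := tauBracket σ ρ₁ ρ₂ α p ξ₀ x t
    have k : a ^ 2 * (br (fun i => 1 / (conj (p i) + Complex.I * a)) (fun _ => 1)
          * br (fun _ => 1) (fun i => 1 / p i)
        - br (fun i => 1 / (conj (p i) + Complex.I * a)) (fun i => 1 / p i)
          * br (fun _ => 1) (fun _ => 1))
        - Complex.I * a ^ 2 * br (fun i => 1 / (conj (p i) + Complex.I * a)) (fun i => 1 / p i)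
        + a * br (fun _ => 1) (fun i => 1 / p i) + Complex.I * br (fun _ => 1) (fun _ => 1)
        + α * br (fun i => 1 / (conj (p i) + Complex.I * α)) (fun _ => 1) = 0 :=
      h.bracket_identity_mixed (wave_ne_zero x t) (hdet x t)
    -- Partial fractions in `p_i*`.
    have k1 : br (fun i => 1 / conj (p i) * (1 / (conj (p i) + Complex.I * a))) (fun _ => 1)
        = -Complex.I / a * br (fun i => 1 / conj (p i)) (fun _ => 1)
          + Complex.I / a * br (fun i => 1 / (conj (p i) + Complex.I * a)) (fun _ => 1) :=
      bracket_left_comb _ _ _ _ _ _ fun i => by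
        have := h.q'_ne i
        have := h.p'_ne i
        field_simp
        linear_combination a * Complex.I_sq
    have k2 : a * br (fun i => 1 / conj (p i) * (1 / (conj (p i) + Complex.I * a))) (fun _ => 1)
        = Complex.I * (br (fun i => 1 / (conj (p i) + Complex.I * a)) (fun _ => 1)
          - br (fun i => 1 / conj (p i)) (fun _ => 1)) := by
      rw [k1]
      field_simp
      ring
    have e1 : ratioF σ ρ₁ ρ₂ α p ξ₀ x t
      = 1 - Complex.I * br (fun _ => 1) (fun _ => 1) := rfl
    have e2 : ∀ b, ratioShift σ ρ₁ ρ₂ α p ξ₀ b x t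
      = 1 + b * br (fun i => 1 / (conj (p i) + Complex.I * b)) (fun _ => 1) := fun b => rfl
    clear_value br
    rw [e1, e2, e2, hl]
    simp only [mul_one]
    generalize br (fun i => 1 / conj (p i) * (1 / (conj (p i) + Complex.I * a))) (fun _ => 1) = B
      at k2 ⊢
    generalize br (fun i => 1 / (conj (p i) + Complex.I * a)) (fun _ => 1) = X at k k2 ⊢
    generalize br (fun i => 1 / (conj (p i) + Complex.I * a)) (fun i => 1 / p i) = V at k ⊢
    generalize br (fun i => 1 / (conj (p i) + Complex.I * α)) (fun _ => 1) = Z at k ⊢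
    generalize br (fun i => 1 / conj (p i)) (fun _ => 1) = S at k2 ⊢
    generalize br (fun _ => 1) (fun i => 1 / p i) = T at k ⊢
    generalize br (fun _ => 1) (fun _ => 1) = W at k ⊢
    generalize (ρ₁ : ℂ) / ρ₂ = r
    linear_combination r * k - Complex.I * r * a * (1 - Complex.I * W) * k2
      + (r * a * (S - X + a * X * S) * (1 - Complex.I * W)
        - r * a * (1 + a * X) * (S + T - Complex.I * W * S) + r * a ^ 2 * V * W) * Complex.I_sq
  · set br := tauBracket σ ρ₁ ρ₂ α p ξ₀ x t
    have k : (a - α) * (ratioF σ ρ₁ ρ₂ α p ξ₀ x t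
        - ratioShift σ ρ₁ ρ₂ α p ξ₀ α x t * ratioShiftStar σ ρ₁ ρ₂ α p ξ₀ α x t)
        = -(α * a) * (br (fun i => 1 / conj (p i)) (fun _ => 1) * ratioF σ ρ₁ ρ₂ α p ξ₀ x t
          + br (fun _ => 1) (fun i => 1 / p i)) :=
      h.bracket_identity_t (hdet x t)
    have hk : (ρ₁ : ℂ) / ρ₂ * (a - α) = σ * ρ₁ ^ 2 * α := by
      rw [ha]
      field_simp
      ring
    have e1 : ratioF σ ρ₁ ρ₂ α p ξ₀ x t
      = 1 - Complex.I * br (fun _ => 1) (fun _ => 1) := rfl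
    clear_value br
    simp only [mul_one]
    rw [hl]
    refine mul_left_cancel₀ hα ?_
    linear_combination -(ρ₁ : ℂ) / ρ₂ * k + (ratioF σ ρ₁ ρ₂ α p ξ₀ x t
        - ratioShift σ ρ₁ ρ₂ α p ξ₀ α x t * ratioShiftStar σ ρ₁ ρ₂ α p ξ₀ α x t) * hk
      + (ρ₁ : ℂ) / ρ₂ * α * a * br (fun i => 1 / conj (p i)) (fun _ => 1) * e1
      + (ρ₁ : ℂ) / ρ₂ * α * a * (br (fun i => 1 / conj (p i)) (fun _ => 1)
        + br (fun _ => 1) (fun i => 1 / p i) - Complex.I * br (fun _ => 1) (fun _ => 1)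
        * br (fun i => 1 / conj (p i)) (fun _ => 1)) * Complex.I_sq

theorem tauF_ne_zero {a : ℝ} (h : IsCircular (a : ℂ) (α : ℂ) p (fun i => conj (p i))) (x t : ℝ) :
    tauF σ ρ₁ ρ₂ α p ξ₀ x t ≠ 0 := by
  rw [tauF_eq]
  exact det_dressing_ne_zero h (wave_ne_zero x t)

theorem isSolution_of_isCircular {a : ℝ} (hρ₁ : ρ₁ ≠ 0) (hρ₂ : ρ₂ ≠ 0)
    (ha : a = α * (1 + σ * ρ₁ * ρ₂))
    (h : IsCircular (a : ℂ) (α : ℂ) p (fun i => conj (p i))) :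
    IsSolution σ (darkU σ ρ₁ ρ₂ α p ξ₀) (darkV σ ρ₁ ρ₂ α p ξ₀) := by
  have hr₁ : (ρ₁ : ℂ) ≠ 0 := by exact_mod_cast hρ₁
  have hr₂ : (ρ₂ : ℂ) ≠ 0 := by exact_mod_cast hρ₂
  have hac : (a : ℂ) = α * (1 + σ * ρ₁ * ρ₂) := by rw [ha]; push_cast; ring
  have hdet : ∀ x t, (tauMatrix σ ρ₁ ρ₂ α p ξ₀ x t).det ≠ 0 := fun x t =>
    det_dressing_ne_zero h (wave_ne_zero x t)
  have hf : ∀ x t, tauF σ ρ₁ ρ₂ α p ξ₀ x t ≠ 0 := tauF_ne_zero h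
  have eF : ∀ x t, conj (tauF σ ρ₁ ρ₂ α p ξ₀ x t)
      = tauF σ ρ₁ ρ₂ α p ξ₀ x t * ratioF σ ρ₁ ρ₂ α p ξ₀ x t := by
    intro x t
    rw [conj_tauF, tauF_eq]
    simp only [tauFStar, expFactor_eq]
    exact det_dressing_sub_const h.add_ne (hdet x t)
  have eG : ∀ x t, tauG σ ρ₁ ρ₂ α p ξ₀ x t
      = tauF σ ρ₁ ρ₂ α p ξ₀ x t * ratioShift σ ρ₁ ρ₂ α p ξ₀ α x t := by
    intro x t
    rw [tauF_eq]
    simp only [tauG, expFactor_eq]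
    exact det_dressing_shift h.add_ne h.b'_ne (hdet x t)
  have eH' : ∀ x t, tauH σ ρ₁ ρ₂ α p ξ₀ x t = (Matrix.of fun i j : Fin N =>
      (if i = j then (1 : ℂ) else 0) + -Complex.I * conj (p j) / (p i + conj (p j))
        * (-((p i - Complex.I * a) / (conj (p j) + Complex.I * a)))
        * expFactor σ ρ₁ ρ₂ α p ξ₀ x t i j).det := by
    intro x t
    rw [hac]
    simp only [tauH, mul_assoc]
  have eH : ∀ x t, tauH σ ρ₁ ρ₂ α p ξ₀ x t
      = tauF σ ρ₁ ρ₂ α p ξ₀ x t * ratioShift σ ρ₁ ρ₂ α p ξ₀ a x t := by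
    intro x t
    rw [tauF_eq, eH']
    simp only [expFactor_eq]
    exact det_dressing_shift h.add_ne h.q'_ne (hdet x t)
  have eGt : ∀ x t, conj (tauG σ ρ₁ ρ₂ α p ξ₀ x t)
      = tauF σ ρ₁ ρ₂ α p ξ₀ x t * ratioShiftStar σ ρ₁ ρ₂ α p ξ₀ α x t := by
    intro x t
    rw [tauF_eq, tauMatrix]
    refine Eq.trans ?_ (det_dressing_shift' h.add_ne h.b_ne (hdet x t))
    rw [tauG, conj_det]
    congr 1
    ext i j
    simp only [Matrix.of_apply, map_add, map_sub, map_mul, map_neg, map_div₀, conj_expFactor,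
      Complex.conj_I, Complex.conj_conj, Complex.conj_ofReal, apply_ite conj, map_one, map_zero,
      eq_comm (a := j), add_comm (conj (p j)), ← expFactor_eq]
    ring
  have eHt : ∀ x t, conj (tauH σ ρ₁ ρ₂ α p ξ₀ x t)
      = tauF σ ρ₁ ρ₂ α p ξ₀ x t * ratioShiftStar σ ρ₁ ρ₂ α p ξ₀ a x t := by
    intro x t
    rw [tauF_eq, tauMatrix]
    refine Eq.trans ?_ (det_dressing_shift' h.add_ne h.q_ne (hdet x t))
    rw [eH', conj_det]
    congr 1
    ext i j
    simp only [Matrix.of_apply, map_add, map_sub, map_mul, map_neg, map_div₀, conj_expFactor,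
      Complex.conj_I, Complex.conj_conj, Complex.conj_ofReal, apply_ite conj, map_one, map_zero,
      eq_comm (a := j), add_comm (conj (p j)), ← expFactor_eq]
    ring
  have hF : ∀ x t, ratioF σ ρ₁ ρ₂ α p ξ₀ x t ≠ 0 := fun x t =>
    right_ne_zero_of_mul (eF x t ▸ (map_ne_zero _).mpr (hf x t))
  have eu : ∀ x t, darkU σ ρ₁ ρ₂ α p ξ₀ x t
      = ρ₁ * (ratioShift σ ρ₁ ρ₂ α p ξ₀ α x t / ratioF σ ρ₁ ρ₂ α p ξ₀ x t)
        * phase σ ρ₁ ρ₂ x t := by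
    intro x t
    rw [darkU, eF, eG, mul_div_mul_left _ _ (hf x t)]
  have ev : ∀ x t, darkV σ ρ₁ ρ₂ α p ξ₀ x t
      = ρ₂ * ratioShift σ ρ₁ ρ₂ α p ξ₀ a x t * phase σ ρ₁ ρ₂ x t := by
    intro x t
    rw [darkV, eH, mul_div_cancel_left₀ _ (hf x t)]
  have euc : ∀ x t, conj (darkU σ ρ₁ ρ₂ α p ξ₀ x t)
      = ρ₁ * ratioShiftStar σ ρ₁ ρ₂ α p ξ₀ α x t * conj (phase σ ρ₁ ρ₂ x t) := by
    intro x t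
    rw [darkU, map_mul, map_mul, map_div₀, Complex.conj_conj, Complex.conj_ofReal, eGt,
      mul_div_cancel_left₀ _ (hf x t)]
  have evc : ∀ x t, conj (darkV σ ρ₁ ρ₂ α p ξ₀ x t)
      = ρ₂ * (ratioShiftStar σ ρ₁ ρ₂ α p ξ₀ a x t / ratioF σ ρ₁ ρ₂ α p ξ₀ x t)
        * conj (phase σ ρ₁ ρ₂ x t) := by
    intro x t
    rw [darkV, map_mul, map_mul, map_div₀, Complex.conj_ofReal, eHt, eF,
      mul_div_mul_left _ _ (hf x t)]
  refine ⟨contDiff_darkU hf, contDiff_darkV hf, fun x t => ?_, fun x t => ?_⟩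
  · obtain ⟨F', G', dF, dG, h1, h2⟩ := exists_hasDerivAt_ratio_x hr₁ hac h hdet x t
    have du := ((dG.fun_div dF (hF x t)).const_mul (ρ₁ : ℂ)).fun_mul
        (hasDerivAt_phase_x (σ := σ) (ρ₁ := ρ₁) (ρ₂ := ρ₂) x t)
    simp only [← eu] at du
    rw [du.deriv, Complex.ofReal_pow, ← Complex.mul_conj', evc, eu, ev]
    exact thirring_eq_of_bilinear_x hr₁ (hF x t) (phase_mul_conj x t) h1 h2
  · obtain ⟨F', H', dF, dH, h1, h2⟩ := exists_hasDerivAt_ratio_t hr₂ hac h hdet x t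
    have dv := (dH.const_mul (ρ₂ : ℂ)).fun_mul
        (hasDerivAt_phase_t (σ := σ) (ρ₁ := ρ₁) (ρ₂ := ρ₂) x t)
    simp only [← ev] at dv
    rw [dv.deriv, Complex.ofReal_pow, ← Complex.mul_conj', euc, eu, ev]
    exact thirring_eq_of_bilinear_t hr₂ (hF x t) (phase_mul_conj x t) h1 h2

/-- Without solitons the background plane wave is a solution. -/
theorem isSolution_background {p ξ₀ : Fin 0 → ℂ} (hρ₁ : ρ₁ ≠ 0) (hρ₂ : ρ₂ ≠ 0) :
    IsSolution σ (darkU σ ρ₁ ρ₂ α p ξ₀) (darkV σ ρ₁ ρ₂ α p ξ₀) := by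
  have hr₁ : (ρ₁ : ℂ) ≠ 0 := by exact_mod_cast hρ₁
  have hr₂ : (ρ₂ : ℂ) ≠ 0 := by exact_mod_cast hρ₂
  have hf : ∀ x t, tauF σ ρ₁ ρ₂ α p ξ₀ x t ≠ 0 := fun x t => by simp [tauF]
  have eu : ∀ x t, darkU σ ρ₁ ρ₂ α p ξ₀ x t = ρ₁ * phase σ ρ₁ ρ₂ x t := fun x t => by
    simp [darkU, tauG, tauF]
  have ev : ∀ x t, darkV σ ρ₁ ρ₂ α p ξ₀ x t = ρ₂ * phase σ ρ₁ ρ₂ x t := fun x t => by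
    simp [darkV, tauH, tauF]
  refine ⟨contDiff_darkU hf, contDiff_darkV hf, fun x t => ?_, fun x t => ?_⟩
  · have du := (hasDerivAt_phase_x (σ := σ) (ρ₁ := ρ₁) (ρ₂ := ρ₂) x t).const_mul (ρ₁ : ℂ)
    simp only [← eu] at du
    rw [du.deriv, Complex.ofReal_pow, ← Complex.mul_conj', eu, ev, map_mul, Complex.conj_ofReal]
    have := phase_mul_conj (σ := σ) (ρ₁ := ρ₁) (ρ₂ := ρ₂) x t
    field_simp
    linear_combination ρ₂ * phase σ ρ₁ ρ₂ x t * (σ * ρ₁ * ρ₂ * this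
      + (1 + σ * ρ₁ * ρ₂) * Complex.I_sq)
  · have dv := (hasDerivAt_phase_t (σ := σ) (ρ₁ := ρ₁) (ρ₂ := ρ₂) x t).const_mul (ρ₂ : ℂ)
    simp only [← ev] at dv
    rw [dv.deriv, Complex.ofReal_pow, ← Complex.mul_conj', eu, ev, map_mul, Complex.conj_ofReal]
    have := phase_mul_conj (σ := σ) (ρ₁ := ρ₁) (ρ₂ := ρ₂) x t
    field_simp
    linear_combination ρ₁ * phase σ ρ₁ ρ₂ x t * (σ * ρ₁ * ρ₂ * this
      + (1 + σ * ρ₁ * ρ₂) * Complex.I_sq)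

end Main
end MassiveThirring

end

theorem mainTheorem2 (N : ℕ) (σ ρ₁ ρ₂ α : ℝ) (p ξ₀ : Fin N → ℂ)
    (hσ : σ = 1 ∨ σ = -1) (hρ₁ : ρ₁ ≠ 0) (hρ₂ : ρ₂ ≠ 0)
    (hp : ∀ i j, p i + (starRingEnd ℂ) (p j) ≠ 0)
    (hconstraint : ∀ i,
      (p i - Complex.I * α * (1 + σ * ρ₁ * ρ₂))
        * ((starRingEnd ℂ) (p i) + Complex.I * α * (1 + σ * ρ₁ * ρ₂))
      = (α : ℂ) ^ 2 * ρ₁ * ρ₂ * (σ + ρ₁ * ρ₂)) :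
    (∀ x t : ℝ, MassiveThirring.tauF σ ρ₁ ρ₂ α p ξ₀ x t ≠ 0) ∧
    (∀ x t : ℝ, (starRingEnd ℂ) (MassiveThirring.tauF σ ρ₁ ρ₂ α p ξ₀ x t)
      = MassiveThirring.tauFStar σ ρ₁ ρ₂ α p ξ₀ x t) ∧
    MassiveThirring.IsSolution σ
      (MassiveThirring.darkU σ ρ₁ ρ₂ α p ξ₀) (MassiveThirring.darkV σ ρ₁ ρ₂ α p ξ₀) := by
  -- For `N = 0` the constraint is void and `α` may vanish, so `IsCircular` is not available.
  rcases N.eq_zero_or_pos with rfl | hN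
  · exact ⟨fun x t => by simp [MassiveThirring.tauF], MassiveThirring.conj_tauF,
      MassiveThirring.isSolution_background hρ₁ hρ₂⟩
  · have : Nonempty (Fin N) := ⟨⟨0, hN⟩⟩
    have h := MassiveThirring.isCircular_of_constraint hσ hp hconstraint
    exact ⟨MassiveThirring.tauF_ne_zero h, MassiveThirring.conj_tauF,
      MassiveThirring.isSolution_of_isCircular hρ₁ hρ₂ rfl h⟩
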